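/- Let $M$ be a smooth, Hausdorff, paracompact $d$-dimensional manifold and let $X\subseteq M$ be closed. Fix a locally finite cover of $M$ by relatively compact smooth charts $\psi_\alpha:V_\alpha\to\mathbb R^d$ and a smooth partition of unity $(\varphi_\alpha)_\alpha$ with $\operatorname{Supp}\varphi_\alpha\subseteq V_\alpha$. For an open set $\Omega\subseteq M$ let $\mathscr E(\Omega)$ be the algebra of smooth functions $\Omega\to\mathbb C$, let $\mathscr D(\Omega)$ be the space of smooth complex functions with compact support contained in $\Omega$, and let $\mathscr D(\Omega)'$ be the space of distributions, i.e. of linear forms on $\mathscr D(\Omega)$ whose restriction to $\mathscr D_K=\{\varphi:\operatorname{Supp}\varphi\subseteq K\}$ is continuous for every compact $K\subseteq\Omega$, where $\mathscr D_K$ carries the topology of uniform convergence of all derivatives on compact subsets of charts. For $f\in\mathscr E(\Omega)$ and $t\in\mathscr D(\Omega)'$ the product is $\langle ft,\varphi\rangle=\langle t,f\varphi\rangle$. A distribution on $M\setminus X$ is *extendible* if it is the restriction of a distribution on $M$. A function $f\in\mathscr E(M\setminus X)$ is *tempered along $X$* if for every $\alpha$, every $k\in\mathbb N$ and every compact $K\subseteq\psi_\alpha(V_\alpha)$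 there are constants $C,s>0$ such that, with $\operatorname{dist}$ the Euclidean distance and $\operatorname{dist}(x,\emptyset)^{-s}=0$, $$\sup_{|\nu|\le k}\bigl|\partial^\nu\bigl((\varphi_\alpha f)\circ\psi_\alpha^{-1}\bigr)(x)\bigr|\le C\bigl[1+\operatorname{dist}\bigl(x,\psi_\alpha(X\cap V_\alpha)\bigr)^{-s}\bigr]\qquad\text{for all }x\in K\setminus\psi_\alpha(X\cap V_\alpha).$$ Then: 1. For every $f\in\mathscr E(M\setminus X)$ tempered along $X$ and every $t\in\mathscr D(M)'$ there is a distribution $\mathcal R(ft)\in\mathscr D(M)'$ whose restriction to $M\setminus X$ is $f\cdot t|_{M\setminus X}$. 2. For every $f\in\mathscr E(M\setminus X)$ tempered along $X$ and every locally finite Borel measure $\mu$ on $M$ (for instance the volume measure of a smooth Riemannian metric), the formula $\varphi\mapsto\int_{M\setminus X}f\varphi\,d\mu$ defines a distribution on $M\setminus X$, and this distribution is extendible. 3. The functions tempered along $X$ form a subalgebra $\mathcal T(X,M)$ of $\mathscr E(M\setminus X)$, and the extendible distributions on $M\setminus X$ form a $\mathcal T(X,M)$-submodule of $\mathscr D(M\setminus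 X)'$. -/

import Mathlib

open TopologicalSpace
open scoped Manifold ContDiff Topology

namespace ManifoldDistribution

/-- Euclidean space `ℝ^d`. -/
abbrev Euc (d : ℕ) : Type := EuclideanSpace ℝ (Fin d)

/-! ### Functions in charts -/

section Charts

variable {d : ℕ} {M : Type*} [TopologicalSpace M] [ChartedSpace (Euc d) M]

theorem contMDiffAt_mul {φ ψ : M → ℂ} {x : M} (hφ : ContMDiffAt (𝓡 d) 𝓘(ℝ, ℂ) ∞ φ x)
    (hψ : ContMDiffAt (𝓡 d) 𝓘(ℝ, ℂ) ∞ ψ x) : ContMDiffAt (𝓡 d) 𝓘(ℝ, ℂ) ∞ (φ * ψ) x :=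
  (contDiff_mul (𝕜 := ℝ) (𝔸 := ℂ) (n := ∞)).comp_contMDiffAt (hφ.prodMk_space hψ)

theorem contDiffOn_chart {e : OpenPartialHomeomorph M (Euc d)}
    (he : e ∈ IsManifold.maximalAtlas (𝓡 d) ∞ M) {U : Set M} {φ : M → ℂ}
    (hφ : ContMDiffOn (𝓡 d) 𝓘(ℝ, ℂ) ∞ φ U) :
    ContDiffOn ℝ ∞ (φ ∘ e.symm) (e.target ∩ e.symm ⁻¹' U) :=
  contMDiffOn_iff_contDiffOn.1 <| hφ.comp
    ((contMDiffOn_symm_of_mem_maximalAtlas he).mono Set.inter_subset_left)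
    Set.inter_subset_right

theorem contDiffAt_chart {e : OpenPartialHomeomorph M (Euc d)}
    (he : e ∈ IsManifold.maximalAtlas (𝓡 d) ∞ M) {φ : M → ℂ}
    (hφ : ContMDiff (𝓡 d) 𝓘(ℝ, ℂ) ∞ φ) {x : Euc d} (hx : x ∈ e.target) :
    ContDiffAt ℝ ∞ (φ ∘ e.symm) x := by
  have := contDiffOn_chart he (hφ.contMDiffOn (s := Set.univ))
  simp only [Set.preimage_univ, Set.inter_univ] at this
  exact this.contDiffAt (e.open_target.mem_nhds hx)

theorem exists_bound_chart {e : OpenPartialHomeomorph M (Euc d)}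
    (he : e ∈ IsManifold.maximalAtlas (𝓡 d) ∞ M) {U : Set M} (hU : IsOpen U) {φ : M → ℂ}
    (hφ : ContMDiffOn (𝓡 d) 𝓘(ℝ, ℂ) ∞ φ U) {L : Set (Euc d)} (hL : IsCompact L)
    (hLt : L ⊆ e.target) (hLU : Set.MapsTo e.symm L U) (j : ℕ) :
    ∃ C : ℝ, ∀ x ∈ L, ‖iteratedFDeriv ℝ j (φ ∘ e.symm) x‖ ≤ C := by
  have hO : IsOpen (e.target ∩ e.symm ⁻¹' U) := e.isOpen_inter_preimage_symm hU
  have hc : ContinuousOn (iteratedFDeriv ℝ j (φ ∘ e.symm)) L := by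
    have h := (contDiffOn_chart he hφ).continuousOn_iteratedFDerivWithin
      (m := j) (mod_cast le_top) hO.uniqueDiffOn
    exact (h.congr (fun x hx => (iteratedFDerivWithin_of_isOpen j hO hx).symm)).mono
      (fun x hx => ⟨hLt hx, hLU hx⟩)
  exact hL.exists_bound_of_continuousOn hc

end Charts

/-! ### Smooth functions, test functions and distributions -/

section Defs

variable {d : ℕ} {M : Type*} [TopologicalSpace M] [ChartedSpace (Euc d) M]

variable (d) in
/-- `𝓔(Ω)`: the algebra of smooth complex valued functions on the open set `Ω`. -/
def SmoothFun (Ω : Opens M) : Subalgebra ℂ (Ω → ℂ) where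
  carrier := {f | ContMDiff (𝓡 d) 𝓘(ℝ, ℂ) ∞ f}
  mul_mem' hf hg := fun x => contMDiffAt_mul (hf x) (hg x)
  add_mem' hf hg := ContMDiff.add hf hg
  algebraMap_mem' _ := contMDiff_const

variable (d) in
/-- `𝓓(Ω)`: smooth functions with compact support contained in the open set `Ω`
(extended by zero to all of `M`). -/
def TestFun (Ω : Opens M) : Submodule ℂ (M → ℂ) where
  carrier := {φ | ContMDiff (𝓡 d) 𝓘(ℝ, ℂ) ∞ φ ∧ HasCompactSupport φ ∧ tsupport φ ⊆ Ω}
  zero_mem' := ⟨contMDiff_const, .zero, by simp [tsupport_zero]⟩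
  add_mem' hf hg := ⟨hf.1.add hg.1, hf.2.1.add hg.2.1,
    (tsupport_add _ _).trans (Set.union_subset hf.2.2 hg.2.2)⟩
  smul_mem' c _ hf := ⟨fun x => contMDiffAt_mul (contMDiffAt_const (c := c)) (hf.1 x), hf.2.1.smul_left (f := fun _ => c),
    (tsupport_smul_subset_right (fun _ => c) _).trans hf.2.2⟩

variable (d) in
/-- `𝓓_K`: smooth functions on `M` with support contained in the compact set `K`. -/
def TestFunOn (K : Compacts M) : Submodule ℂ (M → ℂ) where
  carrier := {φ | ContMDiff (𝓡 d) 𝓘(ℝ, ℂ) ∞ φ ∧ tsupport φ ⊆ K}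
  zero_mem' := ⟨contMDiff_const, by simp [tsupport_zero]⟩
  add_mem' hf hg := ⟨hf.1.add hg.1, (tsupport_add _ _).trans (Set.union_subset hf.2 hg.2)⟩
  smul_mem' c _ hf := ⟨fun x => contMDiffAt_mul (contMDiffAt_const (c := c)) (hf.1 x),
    (tsupport_smul_subset_right (fun _ => c) _).trans hf.2⟩

variable (d M) in
/-- The indices of the seminorms on `𝓓_K`: a smooth chart of `M`, a compact subset of its image,
and an order of differentiation. -/
structure SeminormIndex where
  /-- the chart -/
  chart : OpenPartialHomeomorph M (Euc d)
  chart_mem : chart ∈ IsManifold.maximalAtlas (𝓡 d) ∞ M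
  /-- the compact subset of the image of the chart -/
  cpt : Set (Euc d)
  isCompact : IsCompact cpt
  subset : cpt ⊆ chart.target
  /-- the order of differentiation -/
  order : ℕ

theorem SeminormIndex.bddAbove (p : SeminormIndex d M) {φ : M → ℂ}
    (hφ : ContMDiff (𝓡 d) 𝓘(ℝ, ℂ) ∞ φ) :
    BddAbove (Set.range fun x : p.cpt =>
      ‖iteratedFDeriv ℝ p.order (φ ∘ p.chart.symm) (x : Euc d)‖) := by
  obtain ⟨C, hC⟩ := exists_bound_chart p.chart_mem isOpen_univ hφ.contMDiffOn p.isCompact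
    p.subset (fun _ _ => Set.mem_univ _) p.order
  exact ⟨C, by rintro _ ⟨x, rfl⟩; exact hC x x.2⟩

variable (d) in
/-- The seminorms `φ ↦ sup_{x ∈ L} ‖D^j (φ ∘ ψ⁻¹) (x)‖` on `𝓓_K`, for `ψ` a smooth chart, `L` a
compact subset of its image and `j` an order of differentiation. -/
noncomputable def chartSeminorm (K : Compacts M) :
    SeminormFamily ℂ (TestFunOn d K) (SeminormIndex d M) := fun p =>
  Seminorm.of
    (fun φ => ⨆ x : p.cpt, ‖iteratedFDeriv ℝ p.order ((φ : M → ℂ) ∘ p.chart.symm) (x : Euc d)‖)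
    (fun φ ψ => by
      refine Real.iSup_le (fun x => ?_) (add_nonneg (Real.iSup_nonneg fun _ => norm_nonneg _)
        (Real.iSup_nonneg fun _ => norm_nonneg _))
      have hx := p.subset x.2
      have h : ((φ + ψ : TestFunOn d K) : M → ℂ) ∘ p.chart.symm =
          (φ : M → ℂ) ∘ p.chart.symm + (ψ : M → ℂ) ∘ p.chart.symm := rfl
      rw [h, iteratedFDeriv_add_apply
        ((contDiffAt_chart p.chart_mem φ.2.1 hx).of_le (mod_cast le_top))
        ((contDiffAt_chart p.chart_mem ψ.2.1 hx).of_le (mod_cast le_top))]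
      exact (norm_add_le _ _).trans (add_le_add (le_ciSup (p.bddAbove φ.2.1) x)
        (le_ciSup (p.bddAbove ψ.2.1) x)))
    (fun c φ => by
      rw [Real.mul_iSup_of_nonneg (norm_nonneg c)]
      congr 1
      funext x
      have hx := p.subset x.2
      have h : ((c • φ : TestFunOn d K) : M → ℂ) ∘ p.chart.symm =
          c • ((φ : M → ℂ) ∘ p.chart.symm) := rfl
      rw [h, iteratedFDeriv_const_smul_apply
        ((contDiffAt_chart p.chart_mem φ.2.1 hx).of_le (mod_cast le_top)), norm_smul])

/-- The topology of `𝓓_K`: uniform convergence of all derivatives, on compact subsets of charts. -/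
noncomputable instance (K : Compacts M) : TopologicalSpace (TestFunOn d K) :=
  (chartSeminorm d K).moduleFilterBasis.topology

theorem withSeminorms (K : Compacts M) : WithSeminorms (chartSeminorm d K) := ⟨rfl⟩

/-- The inclusion `𝓓_K ⊆ 𝓓(Ω)` for a compact subset `K` of `Ω`. -/
def TestFunOn.incl {K : Compacts M} {Ω : Opens M} (h : (K : Set M) ⊆ Ω) :
    TestFunOn d K →ₗ[ℂ] TestFun d Ω where
  toFun φ := ⟨φ, φ.2.1, K.isCompact.of_isClosed_subset (isClosed_tsupport _) φ.2.2,
    φ.2.2.trans h⟩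
  map_add' _ _ := rfl
  map_smul' _ _ := rfl

variable (d) in
/-- `𝓓(Ω)'`: the distributions on the open set `Ω`, i.e. the linear forms on `𝓓(Ω)` whose
restriction to `𝓓_K` is continuous for every compact subset `K` of `Ω`. -/
def Distribution (Ω : Opens M) : Submodule ℂ (TestFun d Ω →ₗ[ℂ] ℂ) where
  carrier := {t | ∀ (K : Compacts M) (h : (K : Set M) ⊆ Ω),
    Continuous fun φ : TestFunOn d K => t (TestFunOn.incl h φ)}
  zero_mem' _ _ := continuous_const
  add_mem' hs ht K h := (hs K h).add (ht K h)
  smul_mem' c _ ht K h := (ht K h).const_smul c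

/-- The inclusion `𝓓(U) ⊆ 𝓓(V)` for open sets `U ⊆ V` (extension by zero). -/
def TestFun.incl {U V : Opens M} (h : U ≤ V) : TestFun d U →ₗ[ℂ] TestFun d V where
  toFun φ := ⟨φ, φ.2.1, φ.2.2.1, φ.2.2.2.trans h⟩
  map_add' _ _ := rfl
  map_smul' _ _ := rfl

/-- The restriction of a distribution to a smaller open set. -/
def Distribution.restrict {U V : Opens M} (h : U ≤ V) :
    Distribution d V →ₗ[ℂ] Distribution d U where
  toFun t := ⟨t.1 ∘ₗ TestFun.incl h, fun K hK => t.2 K (hK.trans h)⟩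
  map_add' _ _ := rfl
  map_smul' _ _ := rfl

/-! ### The product of a smooth function and a distribution -/

/-- The extension by zero to `M` of a function defined on an open set `Ω`. -/
noncomputable def extendZero {Ω : Opens M} (f : Ω → ℂ) : M → ℂ :=
  Function.extend Subtype.val f 0

theorem extendZero_coe {Ω : Opens M} (f : Ω → ℂ) (x : Ω) : extendZero f x = f x :=
  Subtype.val_injective.extend_apply f 0 x

theorem contMDiffOn_extendZero {Ω : Opens M} (f : SmoothFun d Ω) :
    ContMDiffOn (𝓡 d) 𝓘(ℝ, ℂ) ∞ (extendZero f.1) Ω := by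
  intro x hx
  refine ContMDiffAt.contMDiffWithinAt ?_
  have h : ContMDiffAt (𝓡 d) 𝓘(ℝ, ℂ) ∞ (fun y : Ω => extendZero f.1 y) ⟨x, hx⟩ := by
    simp only [extendZero_coe]
    exact f.2 ⟨x, hx⟩
  exact contMDiffAt_subtype_iff.1 h

theorem contMDiff_extendZero_mul {Ω : Opens M} (f : SmoothFun d Ω) {φ : M → ℂ}
    (hφ : ContMDiff (𝓡 d) 𝓘(ℝ, ℂ) ∞ φ) (hs : tsupport φ ⊆ Ω) :
    ContMDiff (𝓡 d) 𝓘(ℝ, ℂ) ∞ (extendZero f.1 * φ) := by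
  refine contMDiff_of_tsupport fun x hx => ?_
  have hxΩ : x ∈ Ω := hs (tsupport_mul_subset_right hx)
  exact contMDiffAt_mul ((contMDiffOn_extendZero f).contMDiffAt (Ω.isOpen.mem_nhds hxΩ)) (hφ x)

/-- Multiplication by `f ∈ 𝓔(Ω)` as a linear map `𝓓(Ω) → 𝓓(Ω)`. -/
noncomputable def TestFun.mulLeft {Ω : Opens M} (f : SmoothFun d Ω) :
    TestFun d Ω →ₗ[ℂ] TestFun d Ω where
  toFun φ := ⟨extendZero f.1 * φ, contMDiff_extendZero_mul f φ.2.1 φ.2.2.2, φ.2.2.1.mul_left,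
    tsupport_mul_subset_right.trans φ.2.2.2⟩
  map_add' _ _ := Subtype.ext (mul_add _ _ _)
  map_smul' _ _ := Subtype.ext (mul_smul_comm _ _ _)

/-- Multiplication by `f ∈ 𝓔(Ω)` as a linear map `𝓓_K → 𝓓_K`, for a compact subset `K` of `Ω`. -/
noncomputable def TestFunOn.mulLeft {Ω : Opens M} (f : SmoothFun d Ω) {K : Compacts M}
    (h : (K : Set M) ⊆ Ω) : TestFunOn d K →ₗ[ℂ] TestFunOn d K where
  toFun φ := ⟨extendZero f.1 * φ, contMDiff_extendZero_mul f φ.2.1 (φ.2.2.trans h),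
    tsupport_mul_subset_right.trans φ.2.2⟩
  map_add' _ _ := Subtype.ext (mul_add _ _ _)
  map_smul' _ _ := Subtype.ext (mul_smul_comm _ _ _)

theorem TestFunOn.continuous_mulLeft [T2Space M] {Ω : Opens M} (f : SmoothFun d Ω)
    {K : Compacts M} (h : (K : Set M) ⊆ Ω) : Continuous (TestFunOn.mulLeft f h) := by
  refine WithSeminorms.continuous_of_isBounded (withSeminorms K) (withSeminorms K) _ fun p => ?_
  -- Leibniz' rule on the part of the compact set that the chart maps into `K`
  set e := p.chart
  have hO : IsOpen (e.target ∩ e.symm ⁻¹' (Ω : Set M)) := e.isOpen_inter_preimage_symm Ω.isOpen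
  have hL' : IsCompact (p.cpt ∩ e.symm ⁻¹' (K : Set M)) := by
    refine p.isCompact.of_isClosed_subset ?_ Set.inter_subset_left
    exact (e.continuousOn_symm.mono p.subset).preimage_isClosed_of_isClosed
      p.isCompact.isClosed K.isCompact.isClosed
  choose C hC using fun i => exists_bound_chart p.chart_mem Ω.isOpen (contMDiffOn_extendZero f) hL'
    (Set.inter_subset_left.trans p.subset) (fun x hx => h hx.2) i
  let q : ℕ → SeminormIndex d M := fun i =>
    ⟨e, p.chart_mem, p.cpt, p.isCompact, p.subset, i⟩
  let s : Finset (SeminormIndex d M) := by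
    classical exact (Finset.range (p.order + 1)).image fun i => q (p.order - i)
  let D : NNReal :=
    ∑ i ∈ Finset.range (p.order + 1), (p.order.choose i : NNReal) * (C i).toNNReal
  refine ⟨s, D, fun φ => ?_⟩
  have hD : (0 : ℝ) ≤ D * (s.sup (chartSeminorm d K)) φ := mul_nonneg D.2 (apply_nonneg _ _)
  change _ ≤ (D : ℝ) * (s.sup (chartSeminorm d K)) φ
  refine Real.iSup_le (fun x => ?_) hD
  have hxt : (x : Euc d) ∈ e.target := p.subset x.2
  have heq : ((TestFunOn.mulLeft f h φ : TestFunOn d K) : M → ℂ) ∘ e.symm =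
      fun y => (extendZero f.1 ∘ e.symm) y * ((φ : M → ℂ) ∘ e.symm) y := rfl
  rw [show p.chart = e from rfl, heq]
  by_cases hxK : e.symm x ∈ (K : Set M)
  · have hx : (x : Euc d) ∈ e.target ∩ e.symm ⁻¹' (Ω : Set M) := ⟨hxt, h hxK⟩
    have key := norm_iteratedFDerivWithin_mul_le (𝕜 := ℝ) (n := p.order) (N := ∞)
      (contDiffOn_chart p.chart_mem (contMDiffOn_extendZero f))
      (contDiffOn_chart p.chart_mem (φ.2.1.contMDiffOn (s := (Ω : Set M))))
      hO.uniqueDiffOn hx (mod_cast le_top)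
    rw [iteratedFDerivWithin_of_isOpen _ hO hx] at key
    refine key.trans ?_
    simp only [D, NNReal.coe_sum, Finset.sum_mul, NNReal.coe_mul, NNReal.coe_natCast]
    refine Finset.sum_le_sum fun i hi => ?_
    rw [iteratedFDerivWithin_of_isOpen _ hO hx, iteratedFDerivWithin_of_isOpen _ hO hx]
    have h1 : ‖iteratedFDeriv ℝ i (extendZero f.1 ∘ e.symm) (x : Euc d)‖ ≤ (C i).toNNReal :=
      (hC i x ⟨x.2, hxK⟩).trans (Real.le_coe_toNNReal _)
    have h2 : ‖iteratedFDeriv ℝ (p.order - i) ((φ : M → ℂ) ∘ e.symm) (x : Euc d)‖ ≤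
        (s.sup (chartSeminorm d K)) φ := by
      have h3 : chartSeminorm d K (q (p.order - i)) ≤ s.sup (chartSeminorm d K) :=
        Finset.le_sup (f := chartSeminorm d K) (by
          classical exact Finset.mem_image_of_mem _ hi)
      exact (le_ciSup ((q (p.order - i)).bddAbove φ.2.1) x).trans (h3 φ)
    gcongr
  · have hz : (fun y => (extendZero f.1 ∘ e.symm) y * ((φ : M → ℂ) ∘ e.symm) y) =ᶠ[𝓝 (x : Euc d)]
        fun _ => 0 := by
      have hn : e.symm ⁻¹' (K : Set M)ᶜ ∈ 𝓝 (x : Euc d) :=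
        (e.continuousAt_symm hxt).preimage_mem_nhds
          (K.isCompact.isClosed.isOpen_compl.mem_nhds hxK)
      filter_upwards [hn] with y hy
      have : (φ : M → ℂ) (e.symm y) = 0 :=
        image_eq_zero_of_notMem_tsupport fun hy' => hy (φ.2.2 hy')
      simp [this]
    rw [(hz.iteratedFDeriv ℝ p.order).eq_of_nhds]
    have : iteratedFDeriv ℝ p.order (fun _ : Euc d => (0 : ℂ)) = 0 := iteratedFDeriv_fun_zero
    simpa [this] using hD

/-- The product `f t` of `f ∈ 𝓔(Ω)` and `t ∈ 𝓓(Ω)'`, given by `⟨f t, φ⟩ = ⟨t, f φ⟩`. -/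
noncomputable instance [T2Space M] (Ω : Opens M) : SMul (SmoothFun d Ω) (Distribution d Ω) where
  smul f t := ⟨t.1 ∘ₗ TestFun.mulLeft f,
    fun K h => (t.2 K h).comp (TestFunOn.continuous_mulLeft f h)⟩

theorem Distribution.smul_apply [T2Space M] {Ω : Opens M} (f : SmoothFun d Ω)
    (t : Distribution d Ω) (φ : TestFun d Ω) : (f • t).1 φ = t.1 (TestFun.mulLeft f φ) := rfl

theorem TestFun.apply_eq_zero {Ω : Opens M} (φ : TestFun d Ω) {x : M} (hx : x ∉ Ω) : φ.1 x = 0 :=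
  image_eq_zero_of_notMem_tsupport fun h => hx (φ.2.2.2 h)

/-- Two test functions on `Ω` that agree on `Ω` are equal. -/
theorem TestFun.ext_on {Ω : Opens M} {φ ψ : TestFun d Ω} (h : ∀ x : Ω, φ.1 x = ψ.1 x) :
    φ = ψ := by
  refine Subtype.ext (funext fun x => ?_)
  by_cases hx : x ∈ Ω
  · exact h ⟨x, hx⟩
  · rw [TestFun.apply_eq_zero φ hx, TestFun.apply_eq_zero ψ hx]

theorem TestFun.mulLeft_apply {Ω : Opens M} (f : SmoothFun d Ω) (φ : TestFun d Ω) (x : Ω) :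
    (TestFun.mulLeft f φ).1 x = f.1 x * φ.1 x :=
  congrArg (· * φ.1 x) (extendZero_coe f.1 x)

/-- The distributions on `Ω` form a module over the smooth functions on `Ω`. -/
noncomputable instance [T2Space M] (Ω : Opens M) : Module (SmoothFun d Ω) (Distribution d Ω) where
  one_smul t := Subtype.ext <| LinearMap.ext fun φ => by
    rw [Distribution.smul_apply]
    exact congrArg t.1 (TestFun.ext_on fun x => by rw [TestFun.mulLeft_apply]; exact one_mul _)
  mul_smul f g t := Subtype.ext <| LinearMap.ext fun φ => by
    simp only [Distribution.smul_apply]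
    refine congrArg t.1 (TestFun.ext_on fun x => ?_)
    simp only [TestFun.mulLeft_apply]
    change f.1 x * g.1 x * φ.1 x = _
    ring
  smul_zero f := rfl
  smul_add f s t := rfl
  add_smul f g t := Subtype.ext <| LinearMap.ext fun φ => by
    change t.1 _ = t.1 _ + t.1 _
    rw [← map_add]
    refine congrArg t.1 (TestFun.ext_on fun x => ?_)
    change (TestFun.mulLeft (f + g) φ).1 x =
      (TestFun.mulLeft f φ).1 x + (TestFun.mulLeft g φ).1 x
    simp only [TestFun.mulLeft_apply]
    exact add_mul _ _ _
  zero_smul t := Subtype.ext <| LinearMap.ext fun φ => by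
    rw [Distribution.smul_apply]
    have : TestFun.mulLeft (0 : SmoothFun d Ω) φ = 0 :=
      TestFun.ext_on fun x => by rw [TestFun.mulLeft_apply]; exact zero_mul _
    rw [this, map_zero]; rfl

/-! ### Extendible distributions and tempered functions -/

/-- A distribution on `M ∖ X` is extendible if it is the restriction of a distribution on `M`. -/
def IsExtendible {X : Closeds M} (t : Distribution d X.compl) : Prop :=
  ∃ T : Distribution d (⊤ : Opens M), Distribution.restrict le_top T = t

/-- A function `g` on an open subset `V` of `ℝ^d` is tempered along `Y ⊆ V` if, for every order `k`
and every compact `L ⊆ V`, the derivatives of `g` of order at most `k` are bounded on `L ∖ Y` by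
`C (1 + dist(x, Y)^(-s))` for some positive constants `C` and `s`. Only the values of `g` on `V ∖ Y`
matter. (If `Y` is empty the second summand is `0`.) -/
def IsTemperedOn (V Y : Set (Euc d)) (g : Euc d → ℂ) : Prop :=
  ∀ (k : ℕ) (L : Set (Euc d)), IsCompact L → L ⊆ V → ∃ C s : ℝ, 0 < C ∧ 0 < s ∧
    ∀ x ∈ L \ Y, ∀ j ≤ k, ‖iteratedFDeriv ℝ j g x‖ ≤ C * (1 + Metric.infDist x Y ^ (-s))

variable (d M) in
/-- A locally finite cover of `M` by relatively compact smooth charts, with a subordinate smooth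
partition of unity. -/
structure ChartCover (ι : Type*) where
  /-- the charts -/
  chart : ι → OpenPartialHomeomorph M (Euc d)
  chart_mem : ∀ i, chart i ∈ IsManifold.maximalAtlas (𝓡 d) ∞ M
  locallyFinite : LocallyFinite fun i => (chart i).source
  iUnion_source : ⋃ i, (chart i).source = Set.univ
  relativelyCompact : ∀ i, IsCompact (closure (chart i).source)
  /-- the partition of unity -/
  partition : SmoothPartitionOfUnity ι (𝓡 d) M
  subordinate : partition.IsSubordinate fun i => (chart i).source

/-- A smooth function `f` on `M ∖ X` is tempered along `X` if, for each chart `ψ_i : V_i → ℝ^d` of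
the cover, with partition function `ρ_i`, the function `(ρ_i f) ∘ ψ_i⁻¹` on `ψ_i(V_i)` is tempered
along `ψ_i(X ∩ V_i)`. -/
def IsTempered {ι : Type*} (𝒰 : ChartCover d M ι) {X : Closeds M} (f : SmoothFun d X.compl) :
    Prop :=
  ∀ i, IsTemperedOn (𝒰.chart i).target (𝒰.chart i '' ((X : Set M) ∩ (𝒰.chart i).source))
    ((fun x => (𝒰.partition i x : ℂ) * extendZero f.1 x) ∘ (𝒰.chart i).symm)

end Defs

end ManifoldDistribution

/-!
The heart of the matter is a local estimate. Let `ρ_i` be the partition function of the `i`-th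
chart, with compact support `K_i` in the chart domain, and let `φ` be a test function that vanishes
near `X`. A distribution `t` has finite order on `K_i` (`Distribution.exists_bound`), so
`⟨t, ρ_i f φ⟩` is bounded by finitely many derivatives of `(ρ_i f) φ` in the `i`-th chart. There the
derivatives of `ρ_i f` may grow like a power `dist(x, X)^(-s)`. But `φ` is flat on `X`, so Taylor's
inequality gains a factor `dist(x, X)^N` for each `N` additional derivatives of `φ`, and `N ≥ s`
absorbs the growth (`exists_bound_mul_of_isTemperedOn`). The result,
`IsTempered.exists_bound_cutoff`, bounds `⟨t, ρ_i f φ⟩` by a seminorm of `φ` that is defined for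
all test functions on `M` and sees only what happens in the `i`-th chart domain.

By the Hahn–Banach theorem (`TestFun.exists_extension`) the linear form `φ ↦ ⟨t, ρ_i f φ⟩` extends
to all test functions on `M` with the same bound. Hence the extensions are distributions, each
vanishes on test functions with support off the `i`-th chart domain, and their sum is locally finite.
It is an extension of `f t` (`IsTempered.isExtendible_smul`).

A locally finite measure is itself a distribution on `M`
(`exists_distribution_of_measure`), so the statement on measures is a special case.

For the algebra structure, the only difficulty is that temperedness is a condition on each `ρ_i f`
in its own chart, while `ρ_i f g` involves `g` without a cutoff. Near a compact subset of the `i`-th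
chart, `g` is a finite sum of functions `ρ_j g`, and temperedness passes from the `j`-th chart to
the `i`-th because transition maps and their inverses are locally Lipschitz, so that they distort
distances to `X` only by a bounded factor (`TemperedBound.comp`). So `f` is tempered if and only if
`f` itself satisfies tempered bounds in all charts (`isTempered_iff_isTemperedInCharts`), and these
bounds are stable under sums and products.
-/

namespace ManifoldDistribution

/-! ### Pointwise bounds for derivatives of products and compositions -/

section Calculus

variable {E F : Type*} [NormedAddCommGroup E] [NormedSpace ℝ E] [NormedAddCommGroup F]
  [NormedSpace ℝ F]

/-- A quantitative Leibniz rule at a point. -/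
theorem norm_iteratedFDeriv_mul_le_two_pow {f g : E → ℂ} {x : E} {n : ℕ}
    (hf : ContDiffAt ℝ n f x) (hg : ContDiffAt ℝ n g x) {A B : ℝ}
    (hA : ∀ i ≤ n, ‖iteratedFDeriv ℝ i f x‖ ≤ A) (hB : ∀ i ≤ n, ‖iteratedFDeriv ℝ i g x‖ ≤ B) :
    ‖iteratedFDeriv ℝ n (fun y => f y * g y) x‖ ≤ 2 ^ n * (A * B) := by
  obtain ⟨u, hu, hu'⟩ := eventually_nhds_iff.1
    ((hf.eventually (by simp)).and (hg.eventually (by simp)))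
  have key := norm_iteratedFDerivWithin_mul_le (𝕜 := ℝ) (n := n) (s := u)
    (fun y hy => (hu y hy).1.contDiffWithinAt) (fun y hy => (hu y hy).2.contDiffWithinAt)
    hu'.1.uniqueDiffOn hu'.2 le_rfl
  simp only [iteratedFDerivWithin_of_isOpen _ hu'.1 hu'.2] at key
  refine key.trans ?_
  have hA0 : 0 ≤ A := (norm_nonneg _).trans (hA 0 (Nat.zero_le _))
  have h2 : (2 : ℝ) ^ n = ∑ i ∈ Finset.range (n + 1), (n.choose i : ℝ) := by
    exact_mod_cast (Nat.sum_range_choose n).symm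
  rw [h2, Finset.sum_mul]
  refine Finset.sum_le_sum fun i hi => ?_
  rw [mul_assoc]
  gcongr
  · exact hA i (Nat.lt_succ_iff.1 (Finset.mem_range.1 hi))
  · exact hB _ (Nat.sub_le _ _)

/-- A quantitative Faà di Bruno formula at a point. -/
theorem norm_iteratedFDeriv_comp_le_factorial {g : F → ℂ} {f : E → F} {x : E} {n : ℕ}
    (hg : ContDiffAt ℝ n g (f x)) (hf : ContDiffAt ℝ n f x) {C D : ℝ} (hD1 : 1 ≤ D)
    (hC : ∀ i ≤ n, ‖iteratedFDeriv ℝ i g (f x)‖ ≤ C)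
    (hD : ∀ i ≤ n, ‖iteratedFDeriv ℝ i f x‖ ≤ D) :
    ‖iteratedFDeriv ℝ n (g ∘ f) x‖ ≤ n.factorial * C * D ^ n := by
  obtain ⟨t, ht, ht'⟩ := eventually_nhds_iff.1 (hg.eventually (by simp))
  obtain ⟨u, hu, hu'⟩ := eventually_nhds_iff.1
    ((hf.eventually (by simp)).and (hf.continuousAt.preimage_mem_nhds (ht'.1.mem_nhds ht'.2)))
  have key := norm_iteratedFDerivWithin_comp_le (𝕜 := ℝ) (n := n) (s := u) (t := t) (C := C)
    (D := D) (fun y hy => (ht y hy).contDiffWithinAt) (fun y hy => (hu y hy).1.contDiffWithinAt)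
    le_rfl ht'.1.uniqueDiffOn hu'.1.uniqueDiffOn (fun y hy => (hu y hy).2) hu'.2
  simp only [iteratedFDerivWithin_of_isOpen _ hu'.1 hu'.2,
    iteratedFDerivWithin_of_isOpen _ ht'.1 ht'.2] at key
  refine key hC fun i hi1 hi => (hD i hi).trans ?_
  exact le_self_pow₀ hD1 (by omega)

theorem iteratedFDeriv_eq_zero_of_eventuallyEq {f : E → F} {x : E} (h : f =ᶠ[𝓝 x] 0) (n : ℕ) :
    iteratedFDeriv ℝ n f x = 0 := by
  rw [(h.iteratedFDeriv ℝ n).eq_of_nhds]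
  exact congrFun iteratedFDeriv_fun_zero x

/-- If all derivatives of `f` vanish at `y`, then they are small near `y`, at the expense of
higher derivatives (Taylor's inequality). -/
theorem norm_iteratedFDeriv_le_of_flat {f : E → F} {s : Set E} (hs : Convex ℝ s)
    (hf : ∀ z ∈ s, ContDiffAt ℝ ∞ f z) {y : E} (hy : y ∈ s)
    (hflat : ∀ k, iteratedFDeriv ℝ k f y = 0) {A : ℝ} (N i : ℕ)
    (hA : ∀ z ∈ s, ‖iteratedFDeriv ℝ (i + N) f z‖ ≤ A) {z : E} (hz : z ∈ s) :
    ‖iteratedFDeriv ℝ i f z‖ ≤ A * ‖z - y‖ ^ N := by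
  induction N generalizing i z with
  | zero => simpa using hA z hz
  | succ N ih =>
    have hseg : segment ℝ y z ⊆ s := hs.segment_subset hy hz
    have hA0 : 0 ≤ A := (norm_nonneg _).trans (hA y hy)
    have h := Convex.norm_image_sub_le_of_norm_fderiv_le (𝕜 := ℝ) (f := iteratedFDeriv ℝ i f)
      (C := A * ‖z - y‖ ^ N) (s := segment ℝ y z) (x := y) (y := z)
      (fun w hw => (hf w (hseg hw)).differentiableAt_iteratedFDeriv
        (mod_cast ENat.natCast_lt_top i))
      (fun w hw => by
        rw [norm_fderiv_iteratedFDeriv]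
        refine (ih (i + 1) (fun v hv => ?_) (hseg hw)).trans ?_
        · rw [show i + 1 + N = i + (N + 1) by ring]
          exact hA v hv
        · have hwy : ‖w - y‖ ≤ ‖z - y‖ := by
            have := norm_sub_le_of_mem_segment hw
            simpa using this
          gcongr)
      (convex_segment y z) (left_mem_segment ℝ y z) (right_mem_segment ℝ y z)
    rw [hflat i, sub_zero] at h
    rwa [pow_succ, ← mul_assoc]

theorem exists_bound_iteratedFDeriv_of_isCompact {τ : E → F} {O L : Set E} (hO : IsOpen O)
    (hτ : ContDiffOn ℝ ∞ τ O) (hL : IsCompact L) (hLO : L ⊆ O) (k : ℕ) :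
    ∃ D : ℝ, 1 ≤ D ∧ ∀ x ∈ L, ∀ j ≤ k, ‖iteratedFDeriv ℝ j τ x‖ ≤ D := by
  have hD : ∀ j : ℕ, ∃ D : ℝ, ∀ x ∈ L, ‖iteratedFDeriv ℝ j τ x‖ ≤ D := fun j => by
    refine hL.exists_bound_of_continuousOn ?_
    have h := hτ.continuousOn_iteratedFDerivWithin (m := j) (mod_cast le_top) hO.uniqueDiffOn
    exact (h.congr fun x hx => (iteratedFDerivWithin_of_isOpen j hO hx).symm).mono hLO
  choose D hD using hD
  have hD0 : 0 ≤ ∑ j ∈ Finset.range (k + 1), |D j| := Finset.sum_nonneg fun _ _ => abs_nonneg _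
  refine ⟨1 + ∑ j ∈ Finset.range (k + 1), |D j|, by linarith, fun x hx j hj => ?_⟩
  have h1 : |D j| ≤ ∑ j ∈ Finset.range (k + 1), |D j| :=
    Finset.single_le_sum (f := fun j => |D j|) (fun _ _ => abs_nonneg _)
      (Finset.mem_range.2 (Nat.lt_succ_of_le hj))
  linarith [hD j x hx, le_abs_self (D j)]

end Calculus

/-! ### Tempered bounds on subsets of Euclidean space -/

section Weights

/-- Larger exponents give larger weights, up to a bounded error. At `a = 0` the powers are `0`. -/
theorem rpow_neg_le_one_add {a s s' : ℝ} (ha : 0 ≤ a) (hs : 0 < s) (h : s ≤ s') :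
    a ^ (-s) ≤ 1 + a ^ (-s') := by
  have h' := Real.rpow_nonneg ha (-s')
  rcases ha.eq_or_lt with rfl | ha
  · rw [Real.zero_rpow (by linarith)]
    linarith
  · rcases le_total a 1 with h1 | h1
    · have := Real.rpow_le_rpow_of_exponent_ge ha h1 (neg_le_neg h)
      linarith
    · have := Real.rpow_le_one_of_one_le_of_nonpos h1 (neg_nonpos.2 hs.le)
      linarith

theorem weight_mul_le {a s s' : ℝ} (ha : 0 ≤ a) (hs : 0 < s) (hs' : 0 < s') :
    (1 + a ^ (-s)) * (1 + a ^ (-s')) ≤ 4 * (1 + a ^ (-(s + s'))) := by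
  have h1 := rpow_neg_le_one_add ha hs (show s ≤ s + s' by linarith)
  have h2 := rpow_neg_le_one_add ha hs' (show s' ≤ s + s' by linarith)
  have h3 : a ^ (-s) * a ^ (-s') = a ^ (-(s + s')) := by
    rcases ha.eq_or_lt with rfl | ha
    · rw [Real.zero_rpow (by linarith), Real.zero_rpow (by linarith), mul_zero,
        Real.zero_rpow (by linarith)]
    · rw [← Real.rpow_add ha]
      congr 1
      ring
  nlinarith

end Weights

section Euclidean

variable {d : ℕ}

/-- The derivatives of `g` of order at most `k` are bounded on `S` by `C (1 + dist(x, Y)^(-s))` for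
some positive `C` and `s`. If `Y` is empty, the weight is `1`, since `infDist x ∅ = 0` and
`0 ^ (-s) = 0`. -/
def TemperedBound (Y S : Set (Euc d)) (k : ℕ) (g : Euc d → ℂ) : Prop :=
  ∃ C s : ℝ, 0 < C ∧ 0 < s ∧
    ∀ x ∈ S, ∀ j ≤ k, ‖iteratedFDeriv ℝ j g x‖ ≤ C * (1 + Metric.infDist x Y ^ (-s))

namespace TemperedBound

variable {Y S S' : Set (Euc d)} {k : ℕ} {f g : Euc d → ℂ}

theorem weight_pos (Y : Set (Euc d)) (x : Euc d) (s : ℝ) : 0 < 1 + Metric.infDist x Y ^ (-s) :=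
  add_pos_of_pos_of_nonneg one_pos (Real.rpow_nonneg Metric.infDist_nonneg _)

theorem mono (h : TemperedBound Y S k f) (hS : S' ⊆ S) : TemperedBound Y S' k f := by
  obtain ⟨C, s, hC, hs, hb⟩ := h
  exact ⟨C, s, hC, hs, fun x hx => hb x (hS hx)⟩

theorem congr (h : TemperedBound Y S k f) (hfg : ∀ x ∈ S, g =ᶠ[𝓝 x] f) :
    TemperedBound Y S k g := by
  obtain ⟨C, s, hC, hs, hb⟩ := h
  refine ⟨C, s, hC, hs, fun x hx j hj => ?_⟩
  rw [((hfg x hx).iteratedFDeriv ℝ j).eq_of_nhds]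
  exact hb x hx j hj

theorem of_eventuallyEq_zero (h : TemperedBound Y S' k f)
    (hf : ∀ x ∈ S, x ∉ S' → f =ᶠ[𝓝 x] 0) : TemperedBound Y S k f := by
  obtain ⟨C, s, hC, hs, hb⟩ := h
  refine ⟨C, s, hC, hs, fun x hx j hj => ?_⟩
  by_cases hx' : x ∈ S'
  · exact hb x hx' j hj
  · rw [iteratedFDeriv_eq_zero_of_eventuallyEq (hf x hx hx'), norm_zero]
    exact mul_nonneg hC.le (weight_pos Y x s).le

theorem of_bounded (h : ∀ j, ∃ C : ℝ, ∀ x ∈ S, ‖iteratedFDeriv ℝ j f x‖ ≤ C) :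
    TemperedBound Y S k f := by
  choose C hC using h
  have h0 : 0 ≤ ∑ j ∈ Finset.range (k + 1), |C j| := Finset.sum_nonneg fun _ _ => abs_nonneg _
  refine ⟨1 + ∑ j ∈ Finset.range (k + 1), |C j|, 1, by linarith, one_pos, fun x hx j hj => ?_⟩
  have h1 : |C j| ≤ ∑ j ∈ Finset.range (k + 1), |C j| :=
    Finset.single_le_sum (f := fun j => |C j|) (fun _ _ => abs_nonneg _)
      (Finset.mem_range.2 (Nat.lt_succ_of_le hj))
  refine ((hC j x hx).trans (le_abs_self _)).trans ?_
  have := Real.rpow_nonneg (Metric.infDist_nonneg (x := x) (s := Y)) (-1)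
  nlinarith

/-- The exponent in a tempered bound may be increased. -/
theorem exists_of_le (h : TemperedBound Y S k f) : ∃ s₀ : ℝ, ∀ s, s₀ ≤ s → ∃ C : ℝ, 0 < C ∧
    ∀ x ∈ S, ∀ j ≤ k, ‖iteratedFDeriv ℝ j f x‖ ≤ C * (1 + Metric.infDist x Y ^ (-s)) := by
  obtain ⟨C, s, hC, hs, hb⟩ := h
  refine ⟨s, fun s' hs' => ⟨C * 2, by positivity, fun x hx j hj => (hb x hx j hj).trans ?_⟩⟩
  rw [mul_assoc]
  gcongr
  have := rpow_neg_le_one_add (Metric.infDist_nonneg (x := x) (s := Y)) hs hs'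
  have := Real.rpow_nonneg (Metric.infDist_nonneg (x := x) (s := Y)) (-s')
  linarith

theorem add (hf : TemperedBound Y S k f) (hg : TemperedBound Y S k g)
    (hf' : ∀ x ∈ S, ContDiffAt ℝ ∞ f x) (hg' : ∀ x ∈ S, ContDiffAt ℝ ∞ g x) :
    TemperedBound Y S k (f + g) := by
  obtain ⟨s₁, h₁⟩ := hf.exists_of_le
  obtain ⟨s₂, h₂⟩ := hg.exists_of_le
  obtain ⟨C₁, hC₁, hb₁⟩ := h₁ (max (max s₁ s₂) 1) (by simp)
  obtain ⟨C₂, hC₂, hb₂⟩ := h₂ (max (max s₁ s₂) 1) (by simp)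
  refine ⟨C₁ + C₂, max (max s₁ s₂) 1, by positivity, lt_max_of_lt_right one_pos, fun x hx j hj => ?_⟩
  rw [iteratedFDeriv_add_apply ((hf' x hx).of_le (mod_cast le_top))
    ((hg' x hx).of_le (mod_cast le_top)), add_mul]
  exact (norm_add_le _ _).trans (add_le_add (hb₁ x hx j hj) (hb₂ x hx j hj))

theorem sum {ι : Type*} (J : Finset ι) {h : ι → Euc d → ℂ}
    (hb : ∀ i ∈ J, TemperedBound Y S k (h i)) (hc : ∀ i ∈ J, ∀ x ∈ S, ContDiffAt ℝ ∞ (h i) x) :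
    TemperedBound Y S k (∑ i ∈ J, h i) := by
  classical
  induction J using Finset.induction_on with
  | empty =>
    refine of_bounded fun j => ⟨0, fun x _ => ?_⟩
    rw [Finset.sum_empty, iteratedFDeriv_eq_zero_of_eventuallyEq (by rfl), norm_zero]
  | insert i J hi ih =>
    rw [Finset.sum_insert hi]
    refine (hb i (Finset.mem_insert_self _ _)).add
      (ih (fun i hi => hb i (Finset.mem_insert_of_mem hi))
        fun i hi => hc i (Finset.mem_insert_of_mem hi))
      (hc i (Finset.mem_insert_self _ _)) fun x hx => ?_
    rw [show (∑ i ∈ J, h i) = fun x => ∑ i ∈ J, h i x by ext; simp]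
    exact ContDiffAt.sum fun i hi => hc i (Finset.mem_insert_of_mem hi) x hx

theorem mul (hf : TemperedBound Y S k f) (hg : TemperedBound Y S k g)
    (hf' : ∀ x ∈ S, ContDiffAt ℝ ∞ f x) (hg' : ∀ x ∈ S, ContDiffAt ℝ ∞ g x) :
    TemperedBound Y S k (fun x => f x * g x) := by
  obtain ⟨C₁, s₁, hC₁, hs₁, hb₁⟩ := hf
  obtain ⟨C₂, s₂, hC₂, hs₂, hb₂⟩ := hg
  refine ⟨2 ^ k * (C₁ * C₂ * 4), s₁ + s₂, by positivity, by positivity, fun x hx j hj => ?_⟩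
  refine (norm_iteratedFDeriv_mul_le_two_pow ((hf' x hx).of_le (mod_cast le_top))
    ((hg' x hx).of_le (mod_cast le_top)) (fun i hi => hb₁ x hx i (hi.trans hj))
    (fun i hi => hb₂ x hx i (hi.trans hj))).trans ?_
  have hw := weight_mul_le (Metric.infDist_nonneg (x := x) (s := Y)) hs₁ hs₂
  have h1 := weight_pos Y x s₁
  have h2 := weight_pos Y x s₂
  calc (2 : ℝ) ^ j * (C₁ * (1 + Metric.infDist x Y ^ (-s₁)) *
        (C₂ * (1 + Metric.infDist x Y ^ (-s₂))))
      = 2 ^ j * (C₁ * C₂ * ((1 + Metric.infDist x Y ^ (-s₁)) *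
          (1 + Metric.infDist x Y ^ (-s₂)))) := by ring
    _ ≤ 2 ^ k * (C₁ * C₂ * (4 * (1 + Metric.infDist x Y ^ (-(s₁ + s₂))))) := by
        gcongr
        exact one_le_two
    _ = _ := by ring

end TemperedBound

/-- A tempered function times a smooth function that vanishes near `Y`: the derivatives of the
product are bounded on a compact set by the derivatives of the smooth factor on a larger compact
set. The loss of derivatives makes up for the growth of the tempered factor near `Y`. -/
theorem exists_bound_mul_of_isTemperedOn {V Y : Set (Euc d)} (hV : IsOpen V)
    {g : Euc d → ℂ} (hg : IsTemperedOn V Y g) (hgs : ∀ x ∈ V \ Y, ContDiffAt ℝ ∞ g x)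
    {L : Set (Euc d)} (hL : IsCompact L) (hLV : L ⊆ V) (m : ℕ) :
    ∃ (C : ℝ) (N : ℕ) (L' : Set (Euc d)), IsCompact L' ∧ L' ⊆ V ∧ 0 ≤ C ∧
      ∀ (φ : Euc d → ℂ) (A : ℝ), (∀ x ∈ V, ContDiffAt ℝ ∞ φ x) → (∀ y ∈ Y, φ =ᶠ[𝓝 y] 0) →
        (∀ x ∈ L', ∀ j ≤ N, ‖iteratedFDeriv ℝ j φ x‖ ≤ A) →
        ∀ x ∈ L, ∀ j ≤ m, ‖iteratedFDeriv ℝ j (fun y => g y * φ y) x‖ ≤ C * A := by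
  obtain ⟨C, s, hC, hs, hb⟩ := hg m L hL hLV
  obtain ⟨δ, hδ, hδV⟩ := hL.exists_cthickening_subset_open hV hLV
  -- vanishing of order `n ≥ s` along `Y` absorbs the weight
  set n := ⌈s⌉₊
  have hns : s ≤ n := Nat.le_ceil s
  set Q : ℝ := 1 + δ ^ (-s) + 2 ^ n * δ ^ ((n : ℝ) - s) with hQ
  have hQ1 : 0 ≤ δ ^ (-s) := Real.rpow_nonneg hδ.le _
  have hQ2 : 0 ≤ 2 ^ n * δ ^ ((n : ℝ) - s) := by positivity
  have hQ0 : 1 ≤ Q := by linarith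
  refine ⟨2 ^ m * (C * Q), m + n, Metric.cthickening δ L, hL.cthickening, hδV, by positivity,
    fun φ A hφ hφY hA x hx j hj => ?_⟩
  have hxL' : x ∈ Metric.cthickening δ L := Metric.self_subset_cthickening _ hx
  have hA0 : 0 ≤ A := (norm_nonneg _).trans (hA x hxL' 0 (Nat.zero_le _))
  by_cases hxY : x ∈ Y
  · rw [iteratedFDeriv_eq_zero_of_eventuallyEq]
    · rw [norm_zero]
      positivity
    · filter_upwards [hφY x hxY] with y hy
      simp [hy]
  set r := Metric.infDist x Y with hr
  have hr0 : 0 ≤ r := Metric.infDist_nonneg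
  -- It is enough to bound the derivatives of `φ` by a number that absorbs the weight.
  suffices h : ∃ P, (∀ i ≤ m, ‖iteratedFDeriv ℝ i φ x‖ ≤ P) ∧ (1 + r ^ (-s)) * P ≤ Q * A by
    obtain ⟨P, hP, hPQ⟩ := h
    refine (norm_iteratedFDeriv_mul_le_two_pow ((hgs x ⟨hLV hx, hxY⟩).of_le (mod_cast le_top))
      ((hφ x (hLV hx)).of_le (mod_cast le_top)) (fun i hi => hb x ⟨hx, hxY⟩ i (hi.trans hj))
      (fun i hi => hP i (hi.trans hj))).trans ?_
    have hw := TemperedBound.weight_pos Y x s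
    have hP0 : 0 ≤ P := (norm_nonneg _).trans (hP 0 (Nat.zero_le _))
    calc (2 : ℝ) ^ j * (C * (1 + r ^ (-s)) * P) ≤ 2 ^ m * (C * (1 + r ^ (-s)) * P) := by
          gcongr
          exact one_le_two
      _ = 2 ^ m * (C * ((1 + r ^ (-s)) * P)) := by ring
      _ ≤ 2 ^ m * (C * (Q * A)) := by gcongr
      _ = _ := by ring
  have hAm : ∀ i ≤ m, ‖iteratedFDeriv ℝ i φ x‖ ≤ A := fun i hi => hA x hxL' i (by omega)
  by_cases hcase : 0 < r ∧ r < δ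
  -- Near `Y`: expand `φ` at a point of `Y` at distance less than `2 r`, inside a ball in `V`.
  · obtain ⟨hrpos, hrδ⟩ := hcase
    have hYne : Y.Nonempty := by
      by_contra h
      rw [Set.not_nonempty_iff_eq_empty] at h
      simp [hr, h] at hrpos
    obtain ⟨y, hyY, hxy⟩ := (Metric.infDist_lt_iff (r := min δ (2 * r)) hYne).1
      (lt_min hrδ (by linarith))
    have hball : Metric.closedBall x δ ⊆ Metric.cthickening δ L :=
      Metric.closedBall_subset_cthickening hx δ
    have hP : ∀ i ≤ m, ‖iteratedFDeriv ℝ i φ x‖ ≤ A * (2 * r) ^ n := fun i hi => by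
      refine (norm_iteratedFDeriv_le_of_flat (convex_closedBall x δ)
        (fun z hz => hφ z (hδV (hball hz)))
        (y := y) (by rw [Metric.mem_closedBall']; exact hxy.le.trans (min_le_left _ _))
        (fun k => iteratedFDeriv_eq_zero_of_eventuallyEq (hφY y hyY) k) n i
        (fun z hz => hA z (hball hz) (i + n) (by omega))
        (Metric.mem_closedBall_self hδ.le)).trans ?_
      have : ‖x - y‖ ≤ 2 * r := by
        rw [← dist_eq_norm]
        exact hxy.le.trans (min_le_right _ _)
      gcongr
    refine ⟨min A (A * (2 * r) ^ n), fun i hi => le_min (hAm i hi) (hP i hi), ?_⟩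
    have h1 : r ^ (-s) * (A * (2 * r) ^ n) ≤ 2 ^ n * δ ^ ((n : ℝ) - s) * A := by
      have : r ^ (-s) * r ^ n ≤ δ ^ ((n : ℝ) - s) := by
        rw [← Real.rpow_natCast, ← Real.rpow_add hrpos, neg_add_eq_sub]
        exact Real.rpow_le_rpow hr0 hrδ.le (by linarith)
      calc r ^ (-s) * (A * (2 * r) ^ n) = 2 ^ n * (r ^ (-s) * r ^ n) * A := by ring
        _ ≤ _ := by gcongr
    have h2 : r ^ (-s) * min A (A * (2 * r) ^ n) ≤ r ^ (-s) * (A * (2 * r) ^ n) :=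
      mul_le_mul_of_nonneg_left (min_le_right _ _) (Real.rpow_nonneg hr0 _)
    have h3 : min A (A * (2 * r) ^ n) ≤ A := min_le_left _ _
    have h4 : 0 ≤ δ ^ (-s) * A := by positivity
    rw [hQ]
    linarith [add_mul 1 (r ^ (-s)) (min A (A * (2 * r) ^ n)),
      add_mul (1 + δ ^ (-s)) (2 ^ n * δ ^ ((n : ℝ) - s)) A, add_mul 1 (δ ^ (-s)) A]
  -- Away from `Y` the weight is bounded, and at `r = 0` it is `1`, as `0 ^ (-s) = 0`.
  · refine ⟨A, hAm, mul_le_mul_of_nonneg_right ?_ hA0⟩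
    have h1 : r ^ (-s) ≤ δ ^ (-s) := by
      rcases hr0.eq_or_lt with h0 | h0
      · rw [← h0, Real.zero_rpow (by linarith)]
        exact hQ1
      · have : δ ≤ r := by
          by_contra h
          exact hcase ⟨h0, not_le.1 h⟩
        exact Real.rpow_le_rpow_of_nonpos hδ this (by linarith)
    linarith

/-- The inverse distance to `Y'` at `τ x` is controlled by the inverse distance to `Y` at `x`, if
`τ` has a smooth local inverse `σ` that maps `Y'` into `Y`. -/
theorem exists_rpow_infDist_le {U O' Y Y' L : Set (Euc d)} (hU : IsOpen (U \ Y))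
    (hO' : IsOpen O') {τ σ : Euc d → Euc d} (hL : IsCompact L) (hLU : L ⊆ U)
    (hτ : ContinuousOn τ L) (hτO' : Set.MapsTo τ L O') (hσ : ContDiffOn ℝ ∞ σ O')
    (hστ : ∀ x ∈ L, σ (τ x) = x) (hσY : ∀ y ∈ Y' ∩ O', σ y ∈ Y) {s : ℝ} (hs : 0 < s) :
    ∃ Q : ℝ, 0 ≤ Q ∧ ∀ x ∈ L \ Y,
      Metric.infDist (τ x) Y' ^ (-s) ≤ Q * (1 + Metric.infDist x Y ^ (-s)) := by
  have hτL : IsCompact (τ '' L) := hL.image_of_continuousOn hτ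
  obtain ⟨δ, hδ, hδO⟩ := hτL.exists_cthickening_subset_open hO' hτO'.image_subset
  obtain ⟨Λ, hΛ⟩ := (hτL.cthickening (r := δ)).exists_bound_of_continuousOn
    ((hσ.continuousOn_fderiv_of_isOpen hO' (mod_cast le_top)).mono hδO)
  set Λ' := max Λ 1
  have hΛ' : 0 < Λ' := lt_max_of_lt_right one_pos
  have hq1 : 0 ≤ δ ^ (-s) := by positivity
  have hq2 : 0 ≤ (2 * Λ') ^ s := by positivity
  refine ⟨δ ^ (-s) + (2 * Λ') ^ s, by positivity, fun x hx => ?_⟩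
  set r := Metric.infDist (τ x) Y' with hr
  set q := Metric.infDist x Y with hq
  have hr0 : 0 ≤ r := Metric.infDist_nonneg
  have hq0 : 0 ≤ q := Metric.infDist_nonneg
  have hqs : 0 ≤ q ^ (-s) := Real.rpow_nonneg hq0 _
  -- Either the left side is bounded, or a point of `Y'` near `τ x` is carried by `σ`, which is
  -- Lipschitz near `τ x`, to a point of `Y` near `x`.
  have hbig : r ^ (-s) ≤ δ ^ (-s) ∨ r ^ (-s) ≤ (2 * Λ') ^ s * q ^ (-s) := by
    rcases hr0.eq_or_lt with h0 | h0
    · left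
      rw [← h0, Real.zero_rpow (by linarith)]
      exact hq1
    rcases le_or_gt δ r with h1 | h1
    · exact Or.inl (Real.rpow_le_rpow_of_nonpos hδ h1 (by linarith))
    right
    have hYne : Y'.Nonempty := by
      by_contra h
      rw [Set.not_nonempty_iff_eq_empty] at h
      simp [hr, h] at h0
    obtain ⟨y, hyY, hxy⟩ := (Metric.infDist_lt_iff (r := min δ (2 * r)) hYne).1
      (lt_min h1 (by linarith))
    have hball : Metric.closedBall (τ x) δ ⊆ Metric.cthickening δ (τ '' L) :=
      Metric.closedBall_subset_cthickening (Set.mem_image_of_mem _ hx.1) δ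
    have hyb : y ∈ Metric.closedBall (τ x) δ := by
      rw [Metric.mem_closedBall']
      exact hxy.le.trans (min_le_left _ _)
    have hlip := Convex.norm_image_sub_le_of_norm_fderiv_le (𝕜 := ℝ) (f := σ) (C := Λ')
      (fun z hz => ((hσ.contDiffAt (hO'.mem_nhds (hδO (hball hz)))).differentiableAt (by simp)))
      (fun z hz => (hΛ z (hball hz)).trans (le_max_left _ _)) (convex_closedBall (τ x) δ) hyb
      (Metric.mem_closedBall_self hδ.le)
    rw [hστ x hx.1, ← dist_eq_norm, ← dist_eq_norm] at hlip
    have hσy : σ y ∈ Y := hσY y ⟨hyY, hδO (hball hyb)⟩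
    have hqr : q ≤ 2 * Λ' * r := by
      calc q ≤ dist x (σ y) := Metric.infDist_le_dist_of_mem hσy
        _ ≤ Λ' * dist (τ x) y := hlip
        _ ≤ Λ' * (2 * r) := by
            gcongr
            exact hxy.le.trans (min_le_right _ _)
        _ = _ := by ring
    -- `x` is not in the closure of `Y`, hence its distance to `Y` is positive
    have hqpos : 0 < q := by
      refine hq0.lt_of_ne fun h => ?_
      have hcl : x ∈ closure Y := (Metric.mem_closure_iff_infDist_zero ⟨_, hσy⟩).2 h.symm
      obtain ⟨z, hz, hzY⟩ := mem_closure_iff.1 hcl _ hU ⟨hLU hx.1, hx.2⟩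
      exact hz.2 hzY
    calc r ^ (-s) ≤ (q / (2 * Λ')) ^ (-s) := by
          refine Real.rpow_le_rpow_of_nonpos (by positivity) ?_ (by linarith)
          rw [div_le_iff₀ (by positivity)]
          linarith
      _ = (2 * Λ') ^ s * q ^ (-s) := by
          rw [Real.div_rpow hq0 (by positivity), Real.rpow_neg (by positivity : 0 ≤ 2 * Λ') s,
            div_inv_eq_mul, mul_comm]
  rcases hbig with h | h
  · nlinarith [mul_nonneg hq1 hqs, mul_nonneg hq2 hqs]
  · nlinarith [mul_nonneg hq1 hqs, mul_nonneg hq2 hqs]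

/-- Tempered bounds are preserved by composition with a diffeomorphism. -/
theorem TemperedBound.comp {U O O' Y Y' L : Set (Euc d)} (hU : IsOpen (U \ Y)) (hO : IsOpen O)
    (hO' : IsOpen O') {τ σ : Euc d → Euc d} (hL : IsCompact L) (hLU : L ⊆ U) (hLO : L ⊆ O)
    (hτ : ContDiffOn ℝ ∞ τ O) (hτO' : Set.MapsTo τ L O') (hσ : ContDiffOn ℝ ∞ σ O')
    (hστ : ∀ x ∈ L, σ (τ x) = x) (hσY : ∀ y ∈ Y' ∩ O', σ y ∈ Y) {k : ℕ} {g : Euc d → ℂ}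
    (hg : TemperedBound Y' (τ '' (L \ Y)) k g) (hgs : ∀ x ∈ L \ Y, ContDiffAt ℝ ∞ g (τ x)) :
    TemperedBound Y (L \ Y) k (g ∘ τ) := by
  obtain ⟨C, s, hC, hs, hb⟩ := hg
  obtain ⟨Q, hQ, hq⟩ := exists_rpow_infDist_le hU hO' hL hLU (hτ.continuousOn.mono hLO) hτO' hσ
    hστ hσY hs
  obtain ⟨D', hD'1, hD'⟩ := exists_bound_iteratedFDeriv_of_isCompact hO hτ hL hLO k
  refine ⟨k.factorial * (C * (1 + Q)) * D' ^ k, s, by positivity, hs, fun x hx j hj => ?_⟩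
  refine (norm_iteratedFDeriv_comp_le_factorial ((hgs x hx).of_le (mod_cast le_top))
    ((hτ.contDiffAt (hO.mem_nhds (hLO hx.1))).of_le (mod_cast le_top)) hD'1
    (fun i hi => hb (τ x) (Set.mem_image_of_mem _ hx) i (hi.trans hj))
    (fun i hi => hD' x hx.1 i (hi.trans hj))).trans ?_
  have hw := TemperedBound.weight_pos Y x s
  have hw' := TemperedBound.weight_pos Y' (τ x) s
  have h1 : 1 + Metric.infDist (τ x) Y' ^ (-s) ≤ (1 + Q) * (1 + Metric.infDist x Y ^ (-s)) := by
    have := hq x hx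
    have := Real.rpow_nonneg (Metric.infDist_nonneg (x := x) (s := Y)) (-s)
    linarith
  calc (j.factorial : ℝ) * (C * (1 + Metric.infDist (τ x) Y' ^ (-s))) * D' ^ j
      ≤ k.factorial * (C * ((1 + Q) * (1 + Metric.infDist x Y ^ (-s)))) * D' ^ k := by
        gcongr
    _ = _ := by ring

end Euclidean

/-! ### Changes of charts -/

section ChartDomains

variable {d : ℕ} {M : Type*} [TopologicalSpace M]

theorem comp_symm_eventuallyEq_zero {e : OpenPartialHomeomorph M (Euc d)} {χ : M → ℂ} {x : Euc d}
    (hx : x ∈ e.target) (hχ : e.symm x ∉ tsupport χ) : χ ∘ e.symm =ᶠ[𝓝 x] 0 := by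
  filter_upwards [(e.continuousAt_symm hx).preimage_mem_nhds
    ((isClosed_tsupport χ).isOpen_compl.mem_nhds hχ)] with y hy
  exact image_eq_zero_of_notMem_tsupport (f := χ) hy

theorem image_inter_source_eq (e : OpenPartialHomeomorph M (Euc d)) (X : Set M) :
    e '' (X ∩ e.source) = e.target ∩ e.symm ⁻¹' X := by
  rw [Set.inter_comm, e.image_source_inter_eq']

theorem target_diff_image_eq (e : OpenPartialHomeomorph M (Euc d)) (X : Closeds M) :
    e.target \ (e '' ((X : Set M) ∩ e.source)) = e.target ∩ e.symm ⁻¹' (X.compl : Set M) := by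
  rw [image_inter_source_eq]
  ext x
  simp +contextual

theorem isOpen_target_diff_image (e : OpenPartialHomeomorph M (Euc d)) (X : Closeds M) :
    IsOpen (e.target \ (e '' ((X : Set M) ∩ e.source))) := by
  rw [target_diff_image_eq]
  exact e.isOpen_inter_preimage_symm X.compl.isOpen

theorem extendZero_comp_chart_eventuallyEq {e : OpenPartialHomeomorph M (Euc d)}
    {X : Closeds M} {f : X.compl → ℂ} {g : M → ℂ} (h : ∀ x : X.compl, f x = g x) {x : Euc d}
    (hx : x ∈ e.target \ (e '' ((X : Set M) ∩ e.source))) :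
    extendZero f ∘ e.symm =ᶠ[𝓝 x] g ∘ e.symm := by
  filter_upwards [(isOpen_target_diff_image e X).mem_nhds hx] with y hy
  rw [target_diff_image_eq] at hy
  have := extendZero_coe f ⟨e.symm y, hy.2⟩
  simp only [Function.comp_apply]
  exact this.trans (h _)

end ChartDomains

section Charts

variable {d : ℕ} {M : Type*} [TopologicalSpace M] [ChartedSpace (Euc d) M]

theorem contDiffOn_transition [IsManifold (𝓡 d) ∞ M] {e e' : OpenPartialHomeomorph M (Euc d)}
    (he : e ∈ IsManifold.maximalAtlas (𝓡 d) ∞ M) (he' : e' ∈ IsManifold.maximalAtlas (𝓡 d) ∞ M) :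
    ContDiffOn ℝ ∞ (e' ∘ e.symm) (e.target ∩ e.symm ⁻¹' e'.source) :=
  contMDiffOn_iff_contDiffOn.1 <| (contMDiffOn_of_mem_maximalAtlas he').comp
    ((contMDiffOn_symm_of_mem_maximalAtlas he).mono Set.inter_subset_left)
    Set.inter_subset_right

/-- The derivatives of a function with support in a compact subset `K` of one chart domain,
read in another chart, are bounded by its derivatives on `K` in the first chart. -/
theorem exists_bound_change_chart [IsManifold (𝓡 d) ∞ M] [T2Space M]
    {e : OpenPartialHomeomorph M (Euc d)}
    (he : e ∈ IsManifold.maximalAtlas (𝓡 d) ∞ M) {K : Set M} (hK : IsCompact K)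
    (hKe : K ⊆ e.source) (p : SeminormIndex d M) :
    ∃ C : ℝ, 0 ≤ C ∧ ∀ (χ : M → ℂ) (A : ℝ), ContMDiff (𝓡 d) 𝓘(ℝ, ℂ) ∞ χ → tsupport χ ⊆ K → 0 ≤ A →
      (∀ x ∈ e '' K, ∀ j ≤ p.order, ‖iteratedFDeriv ℝ j (χ ∘ e.symm) x‖ ≤ A) →
      ∀ x ∈ p.cpt, ‖iteratedFDeriv ℝ p.order (χ ∘ p.chart.symm) x‖ ≤ C * A := by
  set e' := p.chart
  set O := e'.target ∩ e'.symm ⁻¹' e.source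
  have hO : IsOpen O := e'.isOpen_inter_preimage_symm e.open_source
  set L := p.cpt ∩ e'.symm ⁻¹' K
  have hL : IsCompact L := p.isCompact.of_isClosed_subset
    ((e'.continuousOn_symm.mono p.subset).preimage_isClosed_of_isClosed
      p.isCompact.isClosed hK.isClosed) Set.inter_subset_left
  have hLO : L ⊆ O := fun x hx => ⟨p.subset hx.1, hKe hx.2⟩
  have hτ : ContDiffOn ℝ ∞ (e ∘ e'.symm) O := contDiffOn_transition p.chart_mem he
  obtain ⟨D, hD1, hD⟩ := exists_bound_iteratedFDeriv_of_isCompact hO hτ hL hLO p.order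
  refine ⟨p.order.factorial * D ^ p.order, by positivity, fun χ A hχ hχK hA0 hA x hx => ?_⟩
  have hxt : x ∈ e'.target := p.subset hx
  by_cases hxK : e'.symm x ∈ K
  · have hxL : x ∈ L := ⟨hx, hxK⟩
    have heq : χ ∘ e'.symm =ᶠ[𝓝 x] (χ ∘ e.symm) ∘ (e ∘ e'.symm) := by
      filter_upwards [hO.mem_nhds (hLO hxL)] with y hy
      simp [e.left_inv hy.2]
    rw [(heq.iteratedFDeriv ℝ p.order).eq_of_nhds]
    refine (norm_iteratedFDeriv_comp_le_factorial (g := χ ∘ e.symm) (f := e ∘ e'.symm)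
      ((contDiffAt_chart he hχ (e.map_source (hKe hxK))).of_le (mod_cast le_top))
      ((hτ.contDiffAt (hO.mem_nhds (hLO hxL))).of_le (mod_cast le_top)) hD1
      (hA _ ⟨_, hxK, rfl⟩) (hD x hxL)).trans (le_of_eq ?_)
    ring
  · rw [iteratedFDeriv_eq_zero_of_eventuallyEq
      (comp_symm_eventuallyEq_zero hxt fun h => hxK (hχK h)), norm_zero]
    positivity

end Charts

variable {d : ℕ} {M : Type*} [TopologicalSpace M] [ChartedSpace (Euc d) M]

/-! ### Seminorms on test functions -/

/-- The seminorms `φ ↦ sup_{x ∈ L} ‖D^j (φ ∘ ψ⁻¹) (x)‖` of `chartSeminorm`, on the space `𝓓(Ω)` of all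
test functions instead of `𝓓_K`: the Hahn–Banach theorem needs a seminorm that is defined without
reference to a compact set `K`. -/
noncomputable def testSeminorm (Ω : Opens M) : SeminormFamily ℂ (TestFun d Ω) (SeminormIndex d M) :=
  fun p => Seminorm.of
    (fun φ => ⨆ x : p.cpt, ‖iteratedFDeriv ℝ p.order ((φ : M → ℂ) ∘ p.chart.symm) (x : Euc d)‖)
    (fun φ ψ => by
      refine Real.iSup_le (fun x => ?_) (add_nonneg (Real.iSup_nonneg fun _ => norm_nonneg _)
        (Real.iSup_nonneg fun _ => norm_nonneg _))
      have hx := p.subset x.2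
      have h : ((φ + ψ : TestFun d Ω) : M → ℂ) ∘ p.chart.symm =
          (φ : M → ℂ) ∘ p.chart.symm + (ψ : M → ℂ) ∘ p.chart.symm := rfl
      rw [h, iteratedFDeriv_add_apply
        ((contDiffAt_chart p.chart_mem φ.2.1 hx).of_le (mod_cast le_top))
        ((contDiffAt_chart p.chart_mem ψ.2.1 hx).of_le (mod_cast le_top))]
      exact (norm_add_le _ _).trans (add_le_add (le_ciSup (p.bddAbove φ.2.1) x)
        (le_ciSup (p.bddAbove ψ.2.1) x)))
    (fun c φ => by
      rw [Real.mul_iSup_of_nonneg (norm_nonneg c)]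
      congr 1
      funext x
      have hx := p.subset x.2
      have h : ((c • φ : TestFun d Ω) : M → ℂ) ∘ p.chart.symm =
          c • ((φ : M → ℂ) ∘ p.chart.symm) := rfl
      rw [h, iteratedFDeriv_const_smul_apply
        ((contDiffAt_chart p.chart_mem φ.2.1 hx).of_le (mod_cast le_top)), norm_smul])

/-- On `𝓓_K` the seminorms `testSeminorm` are those that define the topology. -/
theorem testSeminorm_incl {K : Compacts M} {Ω : Opens M} (h : (K : Set M) ⊆ Ω)
    (s : Finset (SeminormIndex d M)) (φ : TestFunOn d K) :
    s.sup (testSeminorm Ω) (TestFunOn.incl h φ) ≤ s.sup (chartSeminorm d K) φ := by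
  refine Seminorm.finset_sup_apply_le (apply_nonneg _ _) fun p hp => ?_
  exact Seminorm.le_finset_sup_apply (p := chartSeminorm d K) (x := φ) hp

/-- The indices of the seminorms of order at most `N` attached to one compact subset of a chart. -/
noncomputable def seminormIndices {e : OpenPartialHomeomorph M (Euc d)}
    (he : e ∈ IsManifold.maximalAtlas (𝓡 d) ∞ M) {L : Set (Euc d)} (hL : IsCompact L)
    (hLe : L ⊆ e.target) (N : ℕ) : Finset (SeminormIndex d M) := by
  classical exact (Finset.range (N + 1)).image fun j => ⟨e, he, L, hL, hLe, j⟩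

section SeminormIndices

variable {e : OpenPartialHomeomorph M (Euc d)} (he : e ∈ IsManifold.maximalAtlas (𝓡 d) ∞ M)
  {L : Set (Euc d)} (hL : IsCompact L) (hLe : L ⊆ e.target) (N : ℕ) {Ω : Opens M}

theorem norm_iteratedFDeriv_le_testSeminorm (φ : TestFun d Ω) {x : Euc d} (hx : x ∈ L) {j : ℕ}
    (hj : j ≤ N) : ‖iteratedFDeriv ℝ j ((φ : M → ℂ) ∘ e.symm) x‖ ≤
      (seminormIndices he hL hLe N).sup (testSeminorm Ω) φ := by
  have hmem : (⟨e, he, L, hL, hLe, j⟩ : SeminormIndex d M) ∈ seminormIndices he hL hLe N := by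
    classical exact Finset.mem_image_of_mem _ (Finset.mem_range.2 (Nat.lt_succ_of_le hj))
  exact (le_ciSup ((⟨e, he, L, hL, hLe, j⟩ : SeminormIndex d M).bddAbove φ.2.1) ⟨x, hx⟩).trans
    (Seminorm.le_finset_sup_apply (p := testSeminorm Ω) (x := φ) hmem)

theorem testSeminorm_eq_zero (φ : TestFun d Ω) (h : Disjoint e.source (tsupport (φ : M → ℂ))) :
    (seminormIndices he hL hLe N).sup (testSeminorm Ω) φ = 0 := by
  classical
  refine le_antisymm (Seminorm.finset_sup_apply_le le_rfl fun p hp => ?_) (apply_nonneg _ _)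
  obtain ⟨j, -, rfl⟩ := Finset.mem_image.1 hp
  refine Real.iSup_le (fun x => le_of_eq ?_) le_rfl
  rw [iteratedFDeriv_eq_zero_of_eventuallyEq (comp_symm_eventuallyEq_zero (hLe x.2)
    (Set.disjoint_left.1 h (e.map_target (hLe x.2)))), norm_zero]

end SeminormIndices

theorem continuous_of_norm_le {K : Compacts M} (u : TestFunOn d K →ₗ[ℂ] ℂ)
    (s : Finset (SeminormIndex d M)) (C : NNReal)
    (h : ∀ φ, ‖u φ‖ ≤ C * s.sup (chartSeminorm d K) φ) : Continuous u := by
  refine WithSeminorms.continuous_of_isBounded (withSeminorms K) (norm_withSeminorms ℂ ℂ) _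
    fun _ => ⟨s, C, fun φ => ?_⟩
  exact h φ

theorem mem_distribution_of_norm_le {Ω : Opens M} (u : TestFun d Ω →ₗ[ℂ] ℂ)
    (s : Finset (SeminormIndex d M)) (C : NNReal)
    (h : ∀ φ, ‖u φ‖ ≤ C * s.sup (testSeminorm Ω) φ) : u ∈ Distribution d Ω := by
  intro K hK
  refine continuous_of_norm_le (u ∘ₗ TestFunOn.incl hK) s C fun φ => (h _).trans ?_
  gcongr
  exact testSeminorm_incl hK s φ

/-- A distribution has finite order on the functions with support in a compact subset of a chart
domain, and the estimate only needs the derivatives in that chart. -/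
theorem Distribution.exists_bound [IsManifold (𝓡 d) ∞ M] [T2Space M] {Ω : Opens M}
    (t : Distribution d Ω)
    {e : OpenPartialHomeomorph M (Euc d)} (he : e ∈ IsManifold.maximalAtlas (𝓡 d) ∞ M)
    {K : Set M} (hK : IsCompact K) (hKe : K ⊆ e.source) (hKΩ : K ⊆ Ω) :
    ∃ (C : ℝ) (m : ℕ), 0 ≤ C ∧ ∀ (χ : TestFun d Ω) (A : ℝ), tsupport (χ : M → ℂ) ⊆ K → 0 ≤ A →
      (∀ x ∈ e '' K, ∀ j ≤ m, ‖iteratedFDeriv ℝ j ((χ : M → ℂ) ∘ e.symm) x‖ ≤ A) →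
      ‖t.1 χ‖ ≤ C * A := by
  let K' : Compacts M := ⟨K, hK⟩
  let u : TestFunOn d K' →ₗ[ℂ] ℂ := t.1 ∘ₗ TestFunOn.incl (K := K') hKΩ
  have hu : Continuous u := t.2 K' hKΩ
  obtain ⟨s, C, -, hC⟩ := Seminorm.bound_of_continuous (withSeminorms K')
    ((normSeminorm ℂ ℂ).comp u) (continuous_norm.comp hu)
  choose D hD0 hD using exists_bound_change_chart he hK hKe
  refine ⟨C * ∑ p ∈ s, D p, s.sup SeminormIndex.order,
    mul_nonneg C.2 (Finset.sum_nonneg fun p _ => hD0 p), fun χ A hχ hA0 hA => ?_⟩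
  let χ' : TestFunOn d K' := ⟨χ, χ.2.1, hχ⟩
  have h1 : s.sup (chartSeminorm d K') χ' ≤ (∑ p ∈ s, D p) * A := by
    refine Seminorm.finset_sup_apply_le
      (mul_nonneg (Finset.sum_nonneg fun p _ => hD0 p) hA0) fun p hp => ?_
    have h2 : D p ≤ ∑ p ∈ s, D p := Finset.single_le_sum (fun p _ => hD0 p) hp
    refine Real.iSup_le (fun x => ?_) (mul_nonneg (Finset.sum_nonneg fun p _ => hD0 p) hA0)
    refine (hD p χ A χ.2.1 hχ hA0 (fun x hx j hj => hA x hx j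
      (hj.trans (Finset.le_sup (f := SeminormIndex.order) hp))) x x.2).trans ?_
    gcongr
  refine (hC χ').trans ?_
  change (C : ℝ) * s.sup (chartSeminorm d K') χ' ≤ _
  rw [mul_assoc]
  gcongr

/-- Hahn–Banach: a linear form on `𝓓(U)` that is dominated by a seminorm on `𝓓(V)` extends to
`𝓓(V)`, with the same bound. -/
theorem TestFun.exists_extension {U V : Opens M} (h : U ≤ V) (u : TestFun d U →ₗ[ℂ] ℂ)
    (p : Seminorm ℂ (TestFun d V)) (hp : ∀ φ, ‖u φ‖ ≤ p (TestFun.incl h φ)) :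
    ∃ T : TestFun d V →ₗ[ℂ] ℂ, (∀ φ, T (TestFun.incl h φ) = u φ) ∧ ∀ φ, ‖T φ‖ ≤ p φ := by
  have hinj : Function.Injective (TestFun.incl (d := d) h) := fun φ ψ hφψ =>
    Subtype.ext (congrArg (fun χ : TestFun d V => (χ : M → ℂ)) hφψ)
  let E := LinearEquiv.ofInjective (TestFun.incl (d := d) h) hinj
  obtain ⟨T, hT, hTp⟩ := Module.Dual.exists_extension_of_le_seminorm
    (LinearMap.range (TestFun.incl (d := d) h)) (u ∘ₗ E.symm.toLinearMap) (p := p) fun x => by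
      obtain ⟨φ, rfl⟩ := E.surjective x
      change ‖u (E.symm (E φ))‖ ≤ _
      rw [E.symm_apply_apply]
      exact hp φ
  refine ⟨T, fun φ => (hT (E φ)).trans ?_, hTp⟩
  change u (E.symm (E φ)) = _
  rw [E.symm_apply_apply]

namespace ChartCover

variable {ι : Type*} (𝒰 : ChartCover d M ι)

theorem isCompact_tsupport (i : ι) : IsCompact (tsupport (𝒰.partition i)) :=
  (𝒰.relativelyCompact i).of_isClosed_subset (isClosed_tsupport _)
    ((𝒰.subordinate i).trans subset_closure)

theorem finite_inter_compact {K : Set M} (hK : IsCompact K) :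
    {i | ((𝒰.chart i).source ∩ K).Nonempty}.Finite :=
  𝒰.locallyFinite.finite_nonempty_inter_compact hK

/-- The indices of the chart domains that meet a compact set. -/
noncomputable def indices {K : Set M} (hK : IsCompact K) : Finset ι :=
  (𝒰.finite_inter_compact hK).toFinset

theorem mem_indices {K : Set M} (hK : IsCompact K) {x : M} (hx : x ∈ K) {i : ι}
    (hi : x ∈ tsupport (𝒰.partition i)) : i ∈ 𝒰.indices hK :=
  (Set.Finite.mem_toFinset _).2 ⟨x, 𝒰.subordinate i hi, hx⟩

theorem eventually_sum_eq_one {K : Set M} (hK : IsCompact K) {x : M} (hx : x ∈ K) :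
    ∀ᶠ y in 𝓝 x, ∑ i ∈ 𝒰.indices hK, (𝒰.partition i y : ℂ) = 1 := by
  filter_upwards [𝒰.partition.eventually_finsupport_subset x] with y hy
  have hsub : 𝒰.partition.finsupport y ⊆ 𝒰.indices hK := hy.trans fun i hi =>
    𝒰.mem_indices hK hx ((𝒰.partition.mem_fintsupport_iff x i).1 hi)
  have h := 𝒰.partition.sum_finsupport' y (Set.mem_univ y) hsub
  exact_mod_cast h

theorem contMDiff_partition (i : ι) :
    ContMDiff (𝓡 d) 𝓘(ℝ, ℂ) ∞ fun x => (𝒰.partition i x : ℂ) :=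
  Complex.ofRealCLM.contDiff.comp_contMDiff (𝒰.partition i).contMDiff

/-- The sum of distributions `U i`, each of which vanishes off the `i`-th chart domain, is a
distribution: on each compact set only finitely many of them contribute. -/
theorem exists_sum_distribution (U : ι → Distribution d (⊤ : Opens M))
    (hU : ∀ (i : ι) (φ : TestFun d (⊤ : Opens M)),
      Disjoint (𝒰.chart i).source (tsupport (φ : M → ℂ)) → (U i).1 φ = 0) :
    ∃ R : Distribution d (⊤ : Opens M), ∀ (φ : TestFun d (⊤ : Opens M)) (K : Set M)
      (hK : IsCompact K), tsupport (φ : M → ℂ) ⊆ K →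
      R.1 φ = ∑ i ∈ 𝒰.indices hK, (U i).1 φ := by
  have hsupp : ∀ (φ : TestFun d (⊤ : Opens M)) (K : Set M) (hK : IsCompact K),
      tsupport (φ : M → ℂ) ⊆ K → Function.support (fun i => (U i).1 φ) ⊆ 𝒰.indices hK := by
    intro φ K hK hφ i hi
    by_contra hcon
    refine hi (hU i φ (Set.disjoint_iff_inter_eq_empty.2 ?_))
    by_contra hne
    obtain ⟨x, hx⟩ := Set.nonempty_iff_ne_empty.2 hne
    exact hcon (Finset.mem_coe.2 ((Set.Finite.mem_toFinset _).2 ⟨x, hx.1, hφ hx.2⟩))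
  have hfin : ∀ φ : TestFun d (⊤ : Opens M), (Function.support fun i => (U i).1 φ).Finite :=
    fun φ => (Finset.finite_toSet _).subset (hsupp φ _ φ.2.2.1 le_rfl)
  let R : TestFun d (⊤ : Opens M) →ₗ[ℂ] ℂ :=
    { toFun φ := ∑ᶠ i, (U i).1 φ
      map_add' φ ψ := by
        simp only [map_add]
        exact finsum_add_distrib (hfin φ) (hfin ψ)
      map_smul' c φ := by
        simp only [map_smul]
        exact (smul_finsum' c (hfin φ)).symm }
  have hR : ∀ (φ : TestFun d (⊤ : Opens M)) (K : Set M) (hK : IsCompact K),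
      tsupport (φ : M → ℂ) ⊆ K → R φ = ∑ i ∈ 𝒰.indices hK, (U i).1 φ :=
    fun φ K hK hφ => finsum_eq_sum_of_support_subset _ (hsupp φ K hK hφ)
  refine ⟨⟨R, fun K hK => ?_⟩, hR⟩
  have : (fun φ : TestFunOn d K => R (TestFunOn.incl hK φ)) =
      fun φ => ∑ i ∈ 𝒰.indices K.isCompact, (U i).1 (TestFunOn.incl hK φ) :=
    funext fun φ => hR _ _ _ φ.2.2
  rw [this]
  exact continuous_finsetSum _ fun i _ => (U i).2 K hK

end ChartCover

/-! ### Multiplication of distributions by tempered functions -/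

section Tempered

variable {ι : Type*} (𝒰 : ChartCover d M ι) {X : Closeds M}

/-- The product `ρ_i f` of the `i`-th partition function and `f`, on `M ∖ X`. -/
noncomputable def ChartCover.cutoff (i : ι) (f : SmoothFun d X.compl) : SmoothFun d X.compl :=
  ⟨fun x => (𝒰.partition i x : ℂ), (𝒰.contMDiff_partition i).comp contMDiff_subtype_val⟩ * f

theorem ChartCover.extendZero_cutoff (i : ι) (f : SmoothFun d X.compl) :
    extendZero (𝒰.cutoff i f).1 = fun x => (𝒰.partition i x : ℂ) * extendZero f.1 x := by
  funext x
  by_cases hx : x ∈ X.compl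
  · have h1 := extendZero_coe (𝒰.cutoff i f).1 ⟨x, hx⟩
    have h2 := extendZero_coe f.1 ⟨x, hx⟩
    simp only at h1 h2
    rw [h1, h2]
    rfl
  · have h : ∀ g : X.compl → ℂ, extendZero g x = 0 := fun g =>
      Function.extend_apply' _ _ _ fun ⟨y, hy⟩ => hx (hy ▸ y.2)
    rw [h, h, mul_zero]

theorem ChartCover.tsupport_cutoff_subset (i : ι) (f : SmoothFun d X.compl) :
    tsupport (extendZero (𝒰.cutoff i f).1) ⊆ tsupport (𝒰.partition i) :=
  closure_mono fun x hx h0 => hx (by simp [𝒰.extendZero_cutoff, h0])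

theorem contDiffAt_extendZero_chart {e : OpenPartialHomeomorph M (Euc d)}
    (he : e ∈ IsManifold.maximalAtlas (𝓡 d) ∞ M) (f : SmoothFun d X.compl) {x : Euc d}
    (hx : x ∈ e.target \ (e '' ((X : Set M) ∩ e.source))) :
    ContDiffAt ℝ ∞ (extendZero f.1 ∘ e.symm) x := by
  rw [target_diff_image_eq] at hx
  exact (contDiffOn_chart he (contMDiffOn_extendZero f)).contDiffAt
    ((e.isOpen_inter_preimage_symm X.compl.isOpen).mem_nhds hx)

variable {𝒰}

/-- The local estimate: on test functions off `X`, the distribution `ρ_i f t` is bounded by a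
seminorm that makes sense for all test functions on `M` and only involves the `i`-th chart. -/
theorem IsTempered.exists_bound_cutoff [IsManifold (𝓡 d) ∞ M] [T2Space M]
    {f : SmoothFun d X.compl} (hf : IsTempered 𝒰 f)
    (t : Distribution d (⊤ : Opens M)) (i : ι) :
    ∃ (C : NNReal) (L : Set (Euc d)) (hL : IsCompact L) (hLe : L ⊆ (𝒰.chart i).target) (N : ℕ),
      ∀ φ : TestFun d X.compl,
        ‖(𝒰.cutoff i f • (Distribution.restrict le_top t : Distribution d X.compl)).1 φ‖ ≤
          C * (seminormIndices (𝒰.chart_mem i) hL hLe N).sup (testSeminorm ⊤)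
            (TestFun.incl le_top φ) := by
  set e := 𝒰.chart i
  have he := 𝒰.chart_mem i
  have hK := 𝒰.isCompact_tsupport i
  have hKe : tsupport (𝒰.partition i) ⊆ e.source := 𝒰.subordinate i
  obtain ⟨C₁, m, hC₁, h₁⟩ := Distribution.exists_bound t he hK hKe (fun _ _ => trivial)
  have hcomp : (fun x => (𝒰.partition i x : ℂ) * extendZero f.1 x) ∘ e.symm =
      extendZero (𝒰.cutoff i f).1 ∘ e.symm := by rw [𝒰.extendZero_cutoff]
  obtain ⟨C₂, N, L, hL, hLe, hC₂, h₂⟩ := exists_bound_mul_of_isTemperedOn e.open_target (hf i)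
    (fun x hx => by
      rw [hcomp]
      exact contDiffAt_extendZero_chart he (𝒰.cutoff i f) hx)
    (hK.image_of_continuousOn (e.continuousOn.mono hKe))
    (by
      rintro _ ⟨x, hx, rfl⟩
      exact e.map_source (hKe hx)) m
  refine ⟨⟨C₁ * C₂, by positivity⟩, L, hL, hLe, N, fun φ => ?_⟩
  change ‖t.1 (TestFun.incl le_top (TestFun.mulLeft (𝒰.cutoff i f) φ))‖ ≤ C₁ * C₂ * _
  set A := (seminormIndices he hL hLe N).sup (testSeminorm ⊤) (TestFun.incl le_top φ)
  have hA : 0 ≤ A := apply_nonneg _ _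
  rw [mul_assoc]
  refine h₁ _ _ ?_ (by positivity) ?_
  · exact tsupport_mul_subset_left.trans (𝒰.tsupport_cutoff_subset i f)
  · intro x hx j hj
    have := h₂ (φ.1 ∘ e.symm) A (fun x hx => contDiffAt_chart he φ.2.1 hx) (fun y hy => ?_)
      (fun x hx j hj => norm_iteratedFDeriv_le_testSeminorm he hL hLe N
        (TestFun.incl le_top φ) hx hj) x hx j hj
    · rw [hcomp] at this
      exact this
    · rw [image_inter_source_eq] at hy
      exact comp_symm_eventuallyEq_zero hy.1 fun h => φ.2.2.2 h hy.2

/-- The product of a tempered function and the restriction of a distribution on `M` is the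
restriction of a distribution on `M`. -/
theorem IsTempered.isExtendible_smul [IsManifold (𝓡 d) ∞ M] [T2Space M]
    {f : SmoothFun d X.compl} (hf : IsTempered 𝒰 f) (t : Distribution d (⊤ : Opens M)) :
    IsExtendible (f • (Distribution.restrict le_top t : Distribution d X.compl)) := by
  choose C L hL hLe N hb using fun i => hf.exists_bound_cutoff t i
  have hext := fun i => TestFun.exists_extension (le_top : X.compl ≤ ⊤)
    (𝒰.cutoff i f • (Distribution.restrict le_top t : Distribution d X.compl)).1
    (C i • (seminormIndices (𝒰.chart_mem i) (hL i) (hLe i) (N i)).sup (testSeminorm ⊤))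
    (fun φ => hb i φ)
  choose U hUe hUb using hext
  obtain ⟨R, hR⟩ := 𝒰.exists_sum_distribution
    (fun i => ⟨U i, mem_distribution_of_norm_le (U i) _ (C i) (hUb i)⟩) (fun i φ hφ => by
      have := hUb i φ
      rw [smul_apply, testSeminorm_eq_zero _ _ _ _ φ hφ, smul_zero] at this
      exact norm_le_zero_iff.1 this)
  refine ⟨R, Subtype.ext (LinearMap.ext fun φ => ?_)⟩
  change R.1 (TestFun.incl le_top φ) = t.1 (TestFun.incl le_top (TestFun.mulLeft f φ))
  rw [hR _ _ φ.2.2.1 le_rfl]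
  simp only [hUe]
  change ∑ i ∈ _, t.1 (TestFun.incl le_top (TestFun.mulLeft (𝒰.cutoff i f) φ)) = _
  rw [← map_sum, ← map_sum]
  refine congrArg (fun χ => t.1 (TestFun.incl le_top χ)) (Subtype.ext (funext fun x => ?_))
  rw [AddSubmonoidClass.coe_finsetSum, Finset.sum_apply]
  change ∑ i ∈ _, extendZero (𝒰.cutoff i f).1 x * φ.1 x = extendZero f.1 x * φ.1 x
  by_cases hx : x ∈ tsupport φ.1
  · simp only [𝒰.extendZero_cutoff, ← Finset.sum_mul]
    rw [(𝒰.eventually_sum_eq_one φ.2.2.1 hx).self_of_nhds, one_mul]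
  · simp [image_eq_zero_of_notMem_tsupport hx]

end Tempered

/-! ### Measures as distributions -/

/-- A locally finite Borel measure is a distribution. -/
theorem exists_distribution_of_measure [T2Space M] {ι : Type*} (𝒰 : ChartCover d M ι)
    [MeasurableSpace M] [BorelSpace M] (μ : MeasureTheory.Measure M)
    [MeasureTheory.IsLocallyFiniteMeasure μ] :
    ∃ t : Distribution d (⊤ : Opens M), ∀ φ, t.1 φ = ∫ x, φ.1 x ∂μ := by
  have hint : ∀ φ : TestFun d (⊤ : Opens M), MeasureTheory.Integrable φ.1 μ := fun φ =>
    φ.2.1.continuous.integrable_of_hasCompactSupport φ.2.2.1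
  let t : TestFun d (⊤ : Opens M) →ₗ[ℂ] ℂ :=
    { toFun φ := ∫ x, φ.1 x ∂μ
      map_add' φ ψ := MeasureTheory.integral_add (hint φ) (hint ψ)
      map_smul' c φ := MeasureTheory.integral_smul c φ.1 }
  refine ⟨⟨t, fun K hK => ?_⟩, fun _ => rfl⟩
  classical
  have hmem := fun i => 𝒰.chart_mem i
  have hcpt : ∀ i, IsCompact (𝒰.chart i '' tsupport (𝒰.partition i)) := fun i =>
    (𝒰.isCompact_tsupport i).image_of_continuousOn
      ((𝒰.chart i).continuousOn.mono (𝒰.subordinate i))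
  have hsub : ∀ i, 𝒰.chart i '' tsupport (𝒰.partition i) ⊆ (𝒰.chart i).target := fun i => by
    rintro _ ⟨x, hx, rfl⟩
    exact (𝒰.chart i).map_source (𝒰.subordinate i hx)
  let q : ι → SeminormIndex d M := fun i => ⟨𝒰.chart i, hmem i, _, hcpt i, hsub i, 0⟩
  let s : Finset (SeminormIndex d M) := (𝒰.indices K.isCompact).image q
  have hsup : ∀ (φ : TestFunOn d K) (x : M), x ∈ (K : Set M) →
      ‖(φ : M → ℂ) x‖ ≤ s.sup (chartSeminorm d K) φ := fun φ x hx => by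
    obtain ⟨i, hi⟩ : ∃ i, 𝒰.partition i x ≠ 0 := by
      by_contra! h
      have := 𝒰.partition.sum_eq_one (Set.mem_univ x)
      simp [h] at this
    have hxi : x ∈ tsupport (𝒰.partition i) := subset_tsupport _ hi
    have hle := Seminorm.le_finset_sup_apply (p := chartSeminorm d K) (x := φ)
      (Finset.mem_image_of_mem q (𝒰.mem_indices K.isCompact hx hxi))
    refine le_trans ?_ hle
    refine le_trans ?_ (le_ciSup ((q i).bddAbove φ.2.1) ⟨𝒰.chart i x, x, hxi, rfl⟩)
    simp [q, (𝒰.chart i).left_inv (𝒰.subordinate i hxi)]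
  refine continuous_of_norm_le (t ∘ₗ TestFunOn.incl hK) s (μ (K : Set M)).toNNReal fun φ => ?_
  change ‖∫ x, (φ : M → ℂ) x ∂μ‖ ≤ _
  rw [← MeasureTheory.setIntegral_eq_integral_of_forall_compl_eq_zero (s := (K : Set M))
    fun x hx => image_eq_zero_of_notMem_tsupport fun h => hx (φ.2.2 h), mul_comm]
  exact MeasureTheory.norm_setIntegral_le_of_norm_le_const
    K.isCompact.measure_lt_top (hsup φ)

/-! ### The algebra of tempered functions -/

section Tempered

variable {ι : Type*} {𝒰 : ChartCover d M ι} {X : Closeds M}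

/-- `f` itself is tempered, read in each chart of the cover; unlike in `IsTempered`, there is no
partition function in front of `f`. -/
def IsTemperedInCharts (𝒰 : ChartCover d M ι) (f : SmoothFun d X.compl) : Prop :=
  ∀ i k (L : Set (Euc d)), IsCompact L → L ⊆ (𝒰.chart i).target →
    TemperedBound (𝒰.chart i '' ((X : Set M) ∩ (𝒰.chart i).source))
      (L \ (𝒰.chart i '' ((X : Set M) ∩ (𝒰.chart i).source))) k
      (extendZero f.1 ∘ (𝒰.chart i).symm)

theorem temperedBound_of_contMDiff {e : OpenPartialHomeomorph M (Euc d)}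
    (he : e ∈ IsManifold.maximalAtlas (𝓡 d) ∞ M) {φ : M → ℂ}
    (hφ : ContMDiff (𝓡 d) 𝓘(ℝ, ℂ) ∞ φ) {L Y : Set (Euc d)} (hL : IsCompact L) (hLe : L ⊆ e.target)
    (k : ℕ) : TemperedBound Y (L \ Y) k (φ ∘ e.symm) :=
  .of_bounded fun j => by
    obtain ⟨C, hC⟩ := exists_bound_chart he isOpen_univ hφ.contMDiffOn hL hLe
      (fun _ _ => Set.mem_univ _) j
    exact ⟨C, fun x hx => hC x hx.1⟩

theorem IsTemperedInCharts.isTempered {f : SmoothFun d X.compl} (hf : IsTemperedInCharts 𝒰 f) :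
    IsTempered 𝒰 f := fun i k L hL hLe =>
  (temperedBound_of_contMDiff (𝒰.chart_mem i) (𝒰.contMDiff_partition i) hL hLe k).mul
    (hf i k L hL hLe)
    (fun _ hx => contDiffAt_chart (𝒰.chart_mem i) (𝒰.contMDiff_partition i) (hLe hx.1))
    (fun _ hx => contDiffAt_extendZero_chart (𝒰.chart_mem i) f ⟨hLe hx.1, hx.2⟩)

/-- The product `ρ_j f`, which is tempered in the `j`-th chart, is tempered in the `i`-th. -/
theorem IsTempered.temperedBound_cutoff [IsManifold (𝓡 d) ∞ M] {f : SmoothFun d X.compl}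
    (hf : IsTempered 𝒰 f) (i j : ι) (k : ℕ) {L : Set (Euc d)} (hL : IsCompact L)
    (hLe : L ⊆ (𝒰.chart i).target) :
    TemperedBound (𝒰.chart i '' ((X : Set M) ∩ (𝒰.chart i).source))
      (L \ (𝒰.chart i '' ((X : Set M) ∩ (𝒰.chart i).source))) k
      (extendZero (𝒰.cutoff j f).1 ∘ (𝒰.chart i).symm) := by
  set e := 𝒰.chart i
  set e' := 𝒰.chart j
  have he := 𝒰.chart_mem i
  have he' := 𝒰.chart_mem j
  set Y := e '' ((X : Set M) ∩ e.source) with hY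
  set Y' := e' '' ((X : Set M) ∩ e'.source) with hY'
  have hYmem : ∀ {x}, x ∈ Y ↔ x ∈ e.target ∧ e.symm x ∈ (X : Set M) := fun {x} => by
    rw [hY, image_inter_source_eq]; rfl
  have hY'mem : ∀ {x}, x ∈ Y' ↔ x ∈ e'.target ∧ e'.symm x ∈ (X : Set M) := fun {x} => by
    rw [hY', image_inter_source_eq]; rfl
  -- the part of `L` that lies over the support of `ρ_j`
  set L' := L ∩ e.symm ⁻¹' tsupport (𝒰.partition j)
  have hL' : IsCompact L' := hL.of_isClosed_subset
    ((e.continuousOn_symm.mono hLe).preimage_isClosed_of_isClosed hL.isClosed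
      (isClosed_tsupport _)) Set.inter_subset_left
  have hj : tsupport (𝒰.partition j) ⊆ e'.source := 𝒰.subordinate j
  have hL'O : L' ⊆ e.target ∩ e.symm ⁻¹' e'.source := fun x hx => ⟨hLe hx.1, hj hx.2⟩
  have hτ : ContDiffOn ℝ ∞ (e' ∘ e.symm) (e.target ∩ e.symm ⁻¹' e'.source) :=
    contDiffOn_transition he he'
  have hτL : IsCompact ((e' ∘ e.symm) '' L') :=
    hL'.image_of_continuousOn (hτ.continuousOn.mono hL'O)
  have hτY : ∀ x ∈ L' \ Y, (e' ∘ e.symm) x ∈ e'.target \ Y' := fun x hx => by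
    refine ⟨e'.map_source (hj hx.1.2), fun h => hx.2 (hYmem.2 ⟨hLe hx.1.1, ?_⟩)⟩
    have := (hY'mem.1 h).2
    rwa [Function.comp_apply, e'.left_inv (hj hx.1.2)] at this
  have hcut : extendZero (𝒰.cutoff j f).1 ∘ e'.symm =
      (fun x => (𝒰.partition j x : ℂ) * extendZero f.1 x) ∘ e'.symm := by
    rw [𝒰.extendZero_cutoff]
  have hb : TemperedBound Y' ((e' ∘ e.symm) '' (L' \ Y)) k
      (extendZero (𝒰.cutoff j f).1 ∘ e'.symm) := by
    rw [hcut]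
    have h : TemperedBound Y' ((e' ∘ e.symm) '' L' \ Y') k
        ((fun x => (𝒰.partition j x : ℂ) * extendZero f.1 x) ∘ e'.symm) :=
      hf j k _ hτL (by
        rintro _ ⟨x, hx, rfl⟩
        exact e'.map_source (hj hx.2))
    refine h.mono ?_
    rintro _ ⟨x, hx, rfl⟩
    exact ⟨⟨x, hx.1, rfl⟩, (hτY x hx).2⟩
  have key : TemperedBound Y (L' \ Y) k
      ((extendZero (𝒰.cutoff j f).1 ∘ e'.symm) ∘ (e' ∘ e.symm)) := by
    refine TemperedBound.comp (U := e.target) (isOpen_target_diff_image e X)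
      (e.isOpen_inter_preimage_symm e'.open_source) (e'.isOpen_inter_preimage_symm e.open_source)
      hL' (fun x hx => hLe hx.1) hL'O hτ (fun x hx => ⟨e'.map_source (hj hx.2), ?_⟩)
      (contDiffOn_transition he' he) (fun x hx => ?_) (fun y hy => hYmem.2 ⟨?_, ?_⟩) hb
      (fun x hx => contDiffAt_extendZero_chart he' _ (hτY x hx))
    · simp only [Set.mem_preimage, Function.comp_apply, e'.left_inv (hj hx.2)]
      exact e.map_target (hLe hx.1)
    · simp only [Function.comp_apply, e'.left_inv (hj hx.2), e.right_inv (hLe hx.1)]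
    · exact e.map_source hy.2.2
    · rw [Function.comp_apply, e.left_inv hy.2.2]
      exact (hY'mem.1 hy.1).2
  refine TemperedBound.of_eventuallyEq_zero (key.congr fun x hx => ?_) fun x hx hx' => ?_
  · filter_upwards [(e.isOpen_inter_preimage_symm e'.open_source).mem_nhds (hL'O hx.1)] with y hy
    simp only [Function.comp_apply, e'.left_inv hy.2]
  · have hsupp : e.symm x ∉ tsupport (extendZero (𝒰.cutoff j f).1) := fun h =>
      hx' ⟨⟨hx.1, 𝒰.tsupport_cutoff_subset j f h⟩, hx.2⟩
    exact comp_symm_eventuallyEq_zero (hLe hx.1) hsupp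

/-- Temperedness of all products `ρ_i f`, each in its own chart, is temperedness of `f` in all
charts of the cover: near a compact set, `f` is a finite sum of functions `ρ_j f`. -/
theorem isTempered_iff_isTemperedInCharts [IsManifold (𝓡 d) ∞ M] {f : SmoothFun d X.compl} :
    IsTempered 𝒰 f ↔ IsTemperedInCharts 𝒰 f := by
  refine ⟨fun hf i k L hL hLe => ?_, IsTemperedInCharts.isTempered⟩
  have hK : IsCompact ((𝒰.chart i).symm '' L) :=
    hL.image_of_continuousOn ((𝒰.chart i).continuousOn_symm.mono hLe)
  refine (TemperedBound.sum (𝒰.indices hK)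
    (fun j _ => hf.temperedBound_cutoff i j k hL hLe)
    (fun j _ x hx => contDiffAt_extendZero_chart (𝒰.chart_mem i) _ ⟨hLe hx.1, hx.2⟩)).congr
    fun x hx => ?_
  filter_upwards [((𝒰.chart i).continuousAt_symm (hLe hx.1)).eventually
    (𝒰.eventually_sum_eq_one hK ⟨x, hx.1, rfl⟩)] with y hy
  simp only [Finset.sum_apply, Function.comp_apply, 𝒰.extendZero_cutoff, ← Finset.sum_mul]
  rw [hy, one_mul]

/-- The algebra of tempered functions. -/
def temperedSubalgebra [IsManifold (𝓡 d) ∞ M] (𝒰 : ChartCover d M ι) (X : Closeds M) :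
    Subalgebra ℂ (SmoothFun d X.compl) where
  carrier := {f | IsTempered 𝒰 f}
  mul_mem' {f g} hf hg := by
    rw [Set.mem_ofPred, isTempered_iff_isTemperedInCharts] at hf hg ⊢
    intro i k L hL hLe
    refine ((hf i k L hL hLe).mul (hg i k L hL hLe)
      (fun x hx => contDiffAt_extendZero_chart (𝒰.chart_mem i) f ⟨hLe hx.1, hx.2⟩)
      (fun x hx => contDiffAt_extendZero_chart (𝒰.chart_mem i) g ⟨hLe hx.1, hx.2⟩)).congr
      fun x hx => ?_
    refine extendZero_comp_chart_eventuallyEq (g := fun x => extendZero f.1 x * extendZero g.1 x)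
      (fun x => ?_) ⟨hLe hx.1, hx.2⟩
    rw [extendZero_coe, extendZero_coe]
    rfl
  add_mem' {f g} hf hg := by
    rw [Set.mem_ofPred, isTempered_iff_isTemperedInCharts] at hf hg ⊢
    intro i k L hL hLe
    refine ((hf i k L hL hLe).add (hg i k L hL hLe)
      (fun x hx => contDiffAt_extendZero_chart (𝒰.chart_mem i) f ⟨hLe hx.1, hx.2⟩)
      (fun x hx => contDiffAt_extendZero_chart (𝒰.chart_mem i) g ⟨hLe hx.1, hx.2⟩)).congr
      fun x hx => ?_
    refine extendZero_comp_chart_eventuallyEq (g := fun x => extendZero f.1 x + extendZero g.1 x)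
      (fun x => ?_) ⟨hLe hx.1, hx.2⟩
    rw [extendZero_coe, extendZero_coe]
    rfl
  algebraMap_mem' c := by
    rw [Set.mem_ofPred, isTempered_iff_isTemperedInCharts]
    intro i k L hL hLe
    exact (temperedBound_of_contMDiff (𝒰.chart_mem i) (contMDiff_const (c := c)) hL hLe k).congr
      fun x hx => extendZero_comp_chart_eventuallyEq (g := fun _ => c) (fun _ => rfl) ⟨hLe hx.1, hx.2⟩

/-- The module of extendible distributions over the algebra of tempered functions. -/
noncomputable def extendibleSubmodule [IsManifold (𝓡 d) ∞ M] [T2Space M] (𝒰 : ChartCover d M ι)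
    (X : Closeds M) : Submodule (temperedSubalgebra 𝒰 X) (Distribution d X.compl) where
  carrier := {t | IsExtendible t}
  zero_mem' := ⟨0, map_zero _⟩
  add_mem' := by
    rintro _ _ ⟨S, rfl⟩ ⟨T, rfl⟩
    exact ⟨S + T, map_add _ _ _⟩
  smul_mem' := by
    rintro ⟨f, hf⟩ _ ⟨T, rfl⟩
    exact IsTempered.isExtendible_smul hf T

end Tempered

end ManifoldDistribution

open ManifoldDistribution in
theorem theorem6p1 {d : ℕ} {M : Type*} [TopologicalSpace M] [ChartedSpace (Euc d) M]
    [IsManifold (𝓡 d) ∞ M] [T2Space M] [ParacompactSpace M]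
    {ι : Type*} (𝒰 : ChartCover d M ι) (X : Closeds M) :
    -- the product of a tempered function and a distribution on `M` extends to `M`
    (∀ f : SmoothFun d X.compl, IsTempered 𝒰 f → ∀ t : Distribution d (⊤ : Opens M),
      ∃ R : Distribution d (⊤ : Opens M),
        Distribution.restrict le_top R =
          f • (Distribution.restrict le_top t : Distribution d X.compl)) ∧
    -- a tempered function, as a distribution on `M ∖ X`, is extendible
    (∀ f : SmoothFun d X.compl, IsTempered 𝒰 f →
      ∀ [MeasurableSpace M] [BorelSpace M] (μ : MeasureTheory.Measure M)
        [MeasureTheory.IsLocallyFiniteMeasure μ],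
        ∃ t : Distribution d X.compl,
          (∀ φ : TestFun d X.compl, t.1 φ = ∫ x in (X.compl : Set M), extendZero f.1 x * φ.1 x ∂μ) ∧
          IsExtendible t) ∧
    -- the tempered functions form an algebra and the extendible distributions a module over it
    (∃ A : Subalgebra ℂ (SmoothFun d X.compl),
      (∀ f, f ∈ A ↔ IsTempered 𝒰 f) ∧
      ∃ N : Submodule A (Distribution d X.compl), ∀ t, t ∈ N ↔ IsExtendible t) := by
  refine ⟨fun f hf t => hf.isExtendible_smul t, fun f hf _ _ μ _ => ?_,
    temperedSubalgebra 𝒰 X, fun f => Iff.rfl, extendibleSubmodule 𝒰 X, fun t => Iff.rfl⟩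
  obtain ⟨t, ht⟩ := exists_distribution_of_measure 𝒰 μ
  refine ⟨_, fun φ => ?_, hf.isExtendible_smul t⟩
  refine (ht _).trans (MeasureTheory.setIntegral_eq_integral_of_forall_compl_eq_zero
    fun x hx => ?_).symm
  exact TestFun.apply_eq_zero (TestFun.mulLeft f φ) hx
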